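/- Let $\Gamma$ be a locally compact separable metric space and let $\Xi$ be a random measure on $\Gamma$ (a random element of the space of locally finite Borel measures on $\Gamma$). Write $|\Xi|=\Xi(\Gamma)$ and let $\Lambda(A)=\mathbb{E}\,\Xi(A)$ be the mean measure. Suppose that $\Xi$ is completely random, i.e. for every $k\ge 1$ and all pairwise disjoint Borel sets $A_1,\dots,A_k$ the random variables $\Xi(A_1),\dots,\Xi(A_k)$ are independent, that $\mathbb{E}|\Xi|^4<\infty$, and that $B^2:=\operatorname{Var}(|\Xi|)>0$. Let $W=(|\Xi|-\mathbb{E}|\Xi|)/B$ and let $d_{\mathrm K}(\mu,\nu)=\sup_{x\in\mathbb{R}}|\mu((-\infty,x])-\nu((-\infty,x])|$ be the Kolmogorov distance. Then the three sums below are finite and $$d_{\mathrm K}(\mathscr{L}(W),\mathcal{N}(0,1))\le \frac{10}{B^2}\Bigl(\sum_{\alpha\in\Gamma}\mathbb{E}\{\Xi(\{\alpha\})^3\}\Lambda(\{\alpha\})\Bigr)^{1/2}+\frac{5.5}{B^3}\,\mathbb{E}\sum_{\alpha\in\Gamma}\Xi(\{\alpha\})^3+\frac{25.5}{B^3}\sum_{\alpha\in\Gamma}\mathbb{E}\{\Xi(\{\alpha\})^2\}\Lambda(\{\alpha\})$$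 $$\le \frac{10}{B^2}\Bigl(\sum_{\alpha\in\Gamma}\mathbb{E}\{\Xi(\{\alpha\})^3\}\Lambda(\{\alpha\})\Bigr)^{1/2}+\frac{31}{B^3}\,\mathbb{E}\sum_{\alpha\in\Gamma}\Xi(\{\alpha\})^3 .$$ Moreover, if $\Xi$ is a simple Poisson point process on $\Gamma$ whose intensity measure has total mass $\lambda\in(0,\infty)$, then the last expression equals $31\lambda^{-1/2}$, and hence $d_{\mathrm K}(\mathscr{L}(W),\mathcal{N}(0,1))\le 31\lambda^{-1/2}$. -/

import Mathlib

open MeasureTheory ProbabilityTheory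
open scoped ENNReal

noncomputable section

namespace RandomMeasures

/-- The Kolmogorov distance `sup_x |μ((-∞, x]) - ν((-∞, x])|` between two laws on the line. -/
def kolmogorovDist (μ ν : Measure ℝ) : ℝ :=
  ⨆ x : ℝ, |μ.real (Set.Iic x) - ν.real (Set.Iic x)|

/-- The terms in the supremum are bounded, so for probability measures it is a genuine supremum. -/
theorem bddAbove_kolmogorovDist (μ ν : Measure ℝ) [IsProbabilityMeasure μ]
    [IsProbabilityMeasure ν] :
    BddAbove (Set.range fun x : ℝ => |μ.real (Set.Iic x) - ν.real (Set.Iic x)|) := by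
  refine ⟨1, ?_⟩
  rintro _ ⟨x, rfl⟩
  have h1 : μ.real (Set.Iic x) ≤ 1 := measureReal_le_one
  have h2 : ν.real (Set.Iic x) ≤ 1 := measureReal_le_one
  have h3 : 0 ≤ μ.real (Set.Iic x) := measureReal_nonneg
  have h4 : 0 ≤ ν.real (Set.Iic x) := measureReal_nonneg
  exact abs_le.2 ⟨by linarith, by linarith⟩

section

variable {Ω Γ : Type*} [MeasurableSpace Ω] [MeasurableSpace Γ]

/-- A random measure: a measurable map into the locally finite Borel measures on `Γ`, where the
space of measures has the σ-algebra generated by the evaluations `ν ↦ ν A`, `A` Borel. -/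
structure IsRandomMeasure [TopologicalSpace Γ] (Ξ : Ω → Measure Γ) : Prop where
  measurable : Measurable Ξ
  locallyFinite : ∀ ω, IsLocallyFiniteMeasure (Ξ ω)

/-- Complete randomness: for every `k` and all pairwise disjoint Borel sets `A₁, …, A_k`, the
random variables `Ξ(A₁), …, Ξ(A_k)` are (mutually) independent. -/
def IsCompletelyRandom (P : Measure Ω) (Ξ : Ω → Measure Γ) : Prop :=
  ∀ (k : ℕ) (A : Fin k → Set Γ), (∀ i, MeasurableSet (A i)) →
    Pairwise (Function.onFun Disjoint A) → iIndepFun (fun i ω => Ξ ω (A i)) P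

/-- The mean (intensity) measure `Λ(A) = E Ξ(A)`. -/
def meanMeasure (P : Measure Ω) (Ξ : Ω → Measure Γ) : Measure Γ :=
  P.bind Ξ

theorem meanMeasure_apply (P : Measure Ω) {Ξ : Ω → Measure Γ} (hΞ : Measurable Ξ) {A : Set Γ}
    (hA : MeasurableSet A) : meanMeasure P Ξ A = ∫⁻ ω, Ξ ω A ∂P :=
  Measure.bind_apply hA hΞ.aemeasurable

/-- The total mass `|Ξ| = Ξ(Γ)`, as a real random variable. -/
def totalMass (Ξ : Ω → Measure Γ) (ω : Ω) : ℝ :=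
  (Ξ ω).real Set.univ

/-- `B`, the standard deviation of `|Ξ|`. -/
def massStd (P : Measure Ω) (Ξ : Ω → Measure Γ) : ℝ :=
  √(variance (totalMass Ξ) P)

/-- The standardized total mass `W = (|Ξ| - E|Ξ|) / B`. -/
def standardizedMass (P : Measure Ω) (Ξ : Ω → Measure Γ) (ω : Ω) : ℝ :=
  (totalMass Ξ ω - ∫ ω', totalMass Ξ ω' ∂P) / massStd P Ξ

/-- `d_K(L(W), N(0, 1))`. -/
def normalDist (P : Measure Ω) (Ξ : Ω → Measure Γ) : ℝ :=
  kolmogorovDist (P.map (standardizedMass P Ξ)) (gaussianReal 0 1)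

/-- `∑_α E[Ξ({α})³] Λ({α})`, an unordered sum over all points of `Γ`. -/
def sumCubeMean (P : Measure Ω) (Ξ : Ω → Measure Γ) : ℝ≥0∞ :=
  ∑' α : Γ, (∫⁻ ω, Ξ ω {α} ^ 3 ∂P) * meanMeasure P Ξ {α}

/-- `∑_α E[Ξ({α})²] Λ({α})`, an unordered sum over all points of `Γ`. -/
def sumSqMean (P : Measure Ω) (Ξ : Ω → Measure Γ) : ℝ≥0∞ :=
  ∑' α : Γ, (∫⁻ ω, Ξ ω {α} ^ 2 ∂P) * meanMeasure P Ξ {α}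

/-- `E ∑_α Ξ({α})³`. The sum is inside the expectation: it runs over the random atoms of `Ξ`. -/
def meanSumCube (P : Measure Ω) (Ξ : Ω → Measure Γ) : ℝ≥0∞ :=
  ∫⁻ ω, ∑' α : Γ, Ξ ω {α} ^ 3 ∂P

/-- `Ξ` is a Poisson process with intensity measure `Λ`: independent values on disjoint sets, and
`Ξ(A)` is Poisson distributed with parameter `Λ(A)` whenever `Λ(A) < ∞`. -/
structure IsPoissonProcess (P : Measure Ω) (Ξ : Ω → Measure Γ) (Λ : Measure Γ) : Prop where
  indep : IsCompletelyRandom P Ξ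
  law : ∀ A : Set Γ, MeasurableSet A → Λ A < ∞ →
    P.map (fun ω => Ξ ω A) =
      (poissonMeasure (Λ A).toNNReal).map (fun n : ℕ => (n : ℝ≥0∞))

/-- Simplicity of a point process: almost surely no point has multiplicity above one. -/
def IsSimple (P : Measure Ω) (Ξ : Ω → Measure Γ) : Prop :=
  ∀ᵐ ω ∂P, ∀ α : Γ, Ξ ω {α} ≤ 1

end

end RandomMeasures

end

/-! # Normal approximation of the total mass of a completely random measure

For any finite measurable partition of `Γ` the total mass is a sum of independent nonnegative
variables `X i`, the masses of the cells, so its distance to the normal law is governed by a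
Berry–Esseen bound. Two points need care: the constants, and the passage to the limit of fine
partitions.

The Berry–Esseen bound `abs_measureReal_sum_Iic_sub_gaussian_le` is proved by Stein's method. With
`f` the bounded solution of `f' w - w f w = 1_{w ≤ z} - Φ z`, the error is `E f'(W) - E W f(W)`.
Expanding `W = ∑ ξ i` and using that `ξ i` is independent of `W - ξ i`, one compares `f'(W)` with
`f'` at points near `W - ξ i` (`abs_stein_summand_le`). The Lipschitz part of `f'` is harmless; its
jump at `z` is controlled by a concentration inequality for `W - ξ i`
(`measureReal_sum_erase_Icc_le`). The result is
`5.5 ∑ E|ξ i|³ + 10 ∑ E|ξ i| E(ξ i)²`, and for `ξ i = (X i - E X i) / B` with `X i ≥ 0` this is at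
most `(5.5 ∑ E(X i)³ + 25.5 ∑ E(X i)² E(X i)) / B³`.

As the partition is refined to points, `∑ E(X i)³` tends to `E ∑ Ξ({α})³` and
`∑ E(X i)² E(X i)` to `∑ E[Ξ({α})²] Λ({α})`: for finite measures `ν` and `μ`, the sum
`∑ ν(A i)² μ(A i)` is the integral against `μ` of `x ↦ ν(A(x))²`, where `A(x)` is the cell of `x`,
and `A(x)` decreases to `{x}` (`tendsto_sum_cell`). The limit is the bound without its first term,
which is nonnegative. The second inequality is the limit of `E(X i)² E(X i) ≤ E(X i)³`.

For a simple Poisson process the intensity has no atoms, since a Poisson variable bounded by one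
vanishes. The third moments of the cells are `m³ + 3 m² + m` with `m = Λ(A i)`, so the same limit
theorem gives `E ∑ Ξ({α})³ = λ`, while the variance is `λ` and the first term is zero.
-/

namespace RandomMeasures

/-! ### The Stein equation for the standard normal law -/

/-- The unnormalized lower Gaussian tail `∫_{x ≤ w} exp (-x² / 2)`. -/
noncomputable def gaussLower (w : ℝ) : ℝ := ∫ x in Set.Iic w, Real.exp (-(1 / 2) * x ^ 2)

/-- The unnormalized upper Gaussian tail `∫_{x > w} exp (-x² / 2)`. -/
noncomputable def gaussUpper (w : ℝ) : ℝ := ∫ x in Set.Ioi w, Real.exp (-(1 / 2) * x ^ 2)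

lemma integrable_gauss : Integrable fun x : ℝ => Real.exp (-(1 / 2) * x ^ 2) :=
  integrable_exp_neg_mul_sq (by norm_num)

lemma gaussLower_nonneg (w : ℝ) : 0 ≤ gaussLower w :=
  integral_nonneg fun _ => (Real.exp_pos _).le

lemma gaussUpper_nonneg (w : ℝ) : 0 ≤ gaussUpper w :=
  integral_nonneg fun _ => (Real.exp_pos _).le

lemma gaussLower_add_gaussUpper (w : ℝ) : gaussLower w + gaussUpper w = √(2 * Real.pi) := by
  have h := intervalIntegral.integral_Iic_add_Ioi (b := w) integrable_gauss.integrableOn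
    integrable_gauss.integrableOn
  rw [gaussLower, gaussUpper, h, integral_gaussian]
  congr 1; ring

lemma gaussLower_mono : Monotone gaussLower := fun _ _ h =>
  setIntegral_mono_set integrable_gauss.integrableOn
    (Filter.Eventually.of_forall fun _ => (Real.exp_pos _).le)
    (Set.Iic_subset_Iic.2 h).eventuallyLE

lemma gaussUpper_anti : Antitone gaussUpper := fun _ _ h =>
  setIntegral_mono_set integrable_gauss.integrableOn
    (Filter.Eventually.of_forall fun _ => (Real.exp_pos _).le)
    (Set.Ioi_subset_Ioi h).eventuallyLE

lemma hasDerivAt_gaussLower (w : ℝ) :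
    HasDerivAt gaussLower (Real.exp (-(1 / 2) * w ^ 2)) w := by
  have hc : Continuous fun x : ℝ => Real.exp (-(1 / 2) * x ^ 2) := by fun_prop
  have h := (intervalIntegral.integral_hasDerivAt_right (a := 0) (b := w)
    (hc.intervalIntegrable _ _) (hc.stronglyMeasurableAtFilter _ _) hc.continuousAt).const_add
    (gaussLower 0)
  refine h.congr_of_eventuallyEq (Filter.Eventually.of_forall fun u => ?_)
  have := intervalIntegral.integral_Iic_sub_Iic (a := 0) (b := u) integrable_gauss.integrableOn
    integrable_gauss.integrableOn
  simp only [gaussLower, ← this]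
  ring

lemma hasDerivAt_gaussUpper (w : ℝ) :
    HasDerivAt gaussUpper (-Real.exp (-(1 / 2) * w ^ 2)) w := by
  refine ((hasDerivAt_gaussLower w).const_sub √(2 * Real.pi)).congr_of_eventuallyEq
    (Filter.Eventually.of_forall fun u => ?_)
  simp only [← gaussLower_add_gaussUpper u]; ring

lemma gaussLower_eq_gaussUpper_neg (w : ℝ) : gaussLower w = gaussUpper (-w) := by
  rw [gaussLower, gaussUpper, ← integral_comp_neg_Iic]
  simp

lemma sqrt_two_pi_pos : 0 < √(2 * Real.pi) := Real.sqrt_pos.2 (by positivity)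

lemma sqrt_two_pi_le : √(2 * Real.pi) ≤ 4 := by
  rw [Real.sqrt_le_left (by norm_num)]
  nlinarith [Real.pi_le_four]

lemma gaussUpper_zero : gaussUpper 0 = √(2 * Real.pi) / 2 := by
  rw [gaussUpper, integral_gaussian_Ioi]
  congr 2; ring

/-- The Gaussian tail at `w ≥ 0` is at most `exp (-w² / 2)` times the tail at `0`, because
`(w + u)² ≥ w² + u²` for `u ≥ 0`; the tail at `0` is `√(2π) / 2 ≤ 2`. -/
lemma gaussUpper_le (w : ℝ) (hw : 0 ≤ w) :
    gaussUpper w ≤ 2 * Real.exp (-(1 / 2) * w ^ 2) := by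
  have h1 : gaussUpper w = ∫ x in Set.Ioi (0 : ℝ), Real.exp (-(1 / 2) * (x + w) ^ 2) := by
    have := (measurePreserving_add_right volume w).setIntegral_preimage_emb
      (measurableEmbedding_addRight w) (fun x : ℝ => Real.exp (-(1 / 2) * x ^ 2)) (Set.Ioi w)
    rw [gaussUpper, ← this]
    simp
  have h2 : gaussUpper w ≤
      ∫ x in Set.Ioi (0 : ℝ), Real.exp (-(1 / 2) * w ^ 2) * Real.exp (-(1 / 2) * x ^ 2) := by
    rw [h1]
    refine setIntegral_mono_on ?_ (integrable_gauss.integrableOn.const_mul _)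
      measurableSet_Ioi ?_
    · exact (integrable_gauss.comp_add_right w).integrableOn
    · intro x hx
      have hx' : (0 : ℝ) < x := hx
      rw [← Real.exp_add]
      apply Real.exp_le_exp.2
      nlinarith [mul_nonneg hx'.le hw]
  rw [integral_const_mul] at h2
  have h3 : ∫ x in Set.Ioi (0 : ℝ), Real.exp (-(1 / 2) * x ^ 2) ≤ 2 := by
    have := gaussUpper_zero
    rw [gaussUpper] at this
    rw [this]; linarith [sqrt_two_pi_le]
  nlinarith [Real.exp_pos (-(1 / 2) * w ^ 2)]

/-- Mills' ratio bound for the Gaussian tail. -/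
lemma mul_gaussUpper_le (w : ℝ) (hw : 0 ≤ w) :
    w * gaussUpper w ≤ Real.exp (-(1 / 2) * w ^ 2) := by
  have hlim : Filter.Tendsto (fun x : ℝ => -Real.exp (-(1 / 2) * x ^ 2)) Filter.atTop
      (nhds (-0)) := by
    refine (Real.tendsto_exp_atBot.comp ?_).neg
    have : Filter.Tendsto (fun x : ℝ => x ^ 2) Filter.atTop Filter.atTop :=
      Filter.tendsto_pow_atTop (by norm_num)
    exact this.const_mul_atTop_of_neg (by norm_num)
  have hder : ∀ x ∈ Set.Ici w, HasDerivAt (fun x : ℝ => -Real.exp (-(1 / 2) * x ^ 2))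
      (x * Real.exp (-(1 / 2) * x ^ 2)) x := by
    intro x _
    have h := (((hasDerivAt_pow 2 x).const_mul (-(1 / 2 : ℝ))).exp).neg
    refine h.congr_deriv ?_
    push_cast
    ring
  have hint : IntegrableOn (fun x : ℝ => x * Real.exp (-(1 / 2) * x ^ 2)) (Set.Ioi w) :=
    integrableOn_Ioi_deriv_of_nonneg' hder
      (fun x hx => mul_nonneg (hw.trans (le_of_lt hx)) (Real.exp_pos _).le) hlim
  have heq := integral_Ioi_of_hasDerivAt_of_tendsto' hder hint hlim
  have : w * gaussUpper w ≤ ∫ x in Set.Ioi w, x * Real.exp (-(1 / 2) * x ^ 2) := by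
    rw [gaussUpper, ← integral_const_mul]
    refine setIntegral_mono_on (integrable_gauss.integrableOn.const_mul _) hint
      measurableSet_Ioi fun x hx => ?_
    exact mul_le_mul_of_nonneg_right (le_of_lt hx) (Real.exp_pos _).le
  rw [heq] at this
  linarith

lemma gaussianReal_real_Iic (z : ℝ) :
    (gaussianReal 0 1).real (Set.Iic z) = gaussLower z / √(2 * Real.pi) := by
  rw [Measure.real, gaussianReal_apply_eq_integral 0 one_ne_zero,
    ENNReal.toReal_ofReal (integral_nonneg fun _ => gaussianPDFReal_nonneg _ _ _),
    gaussLower, div_eq_inv_mul, ← integral_const_mul]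
  refine integral_congr_ae (Filter.Eventually.of_forall fun x => ?_)
  simp only [gaussianPDFReal, NNReal.coe_one, mul_one, sub_zero]
  congr 2
  ring

/-- The bounded solution of the Stein equation `f' w - w * f w = 1_{w ≤ z} - Φ z`. The minimum and
the maximum put the two branches `w ≤ z` and `z ≤ w` into one formula. -/
noncomputable def steinSol (z w : ℝ) : ℝ :=
  Real.exp (1 / 2 * w ^ 2) * gaussLower (min w z) * gaussUpper (max w z) / √(2 * Real.pi)

/-- The derivative of `steinSol z` away from `z`, as given by the Stein equation. -/
noncomputable def steinDeriv (z w : ℝ) : ℝ :=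
  w * steinSol z w + (Set.Iic z).indicator (fun _ => (1 : ℝ)) w
    - (gaussianReal 0 1).real (Set.Iic z)

lemma continuous_steinSol (z : ℝ) : Continuous (steinSol z) := by
  have h1 : Continuous gaussLower := continuous_iff_continuousAt.2 fun w =>
    (hasDerivAt_gaussLower w).continuousAt
  have h2 : Continuous gaussUpper := continuous_iff_continuousAt.2 fun w =>
    (hasDerivAt_gaussUpper w).continuousAt
  unfold steinSol
  fun_prop

lemma measurable_steinDeriv (z : ℝ) : Measurable (steinDeriv z) := by
  unfold steinDeriv
  have := (continuous_steinSol z).measurable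
  have h2 : Measurable ((Set.Iic z).indicator fun _ => (1 : ℝ)) :=
    measurable_const.indicator measurableSet_Iic
  fun_prop

lemma exp_mul_exp_neg (w : ℝ) :
    Real.exp (1 / 2 * w ^ 2) * Real.exp (-(1 / 2) * w ^ 2) = 1 := by
  rw [← Real.exp_add]; simp

lemma steinSol_nonneg (z w : ℝ) : 0 ≤ steinSol z w := by
  have := gaussLower_nonneg (min w z)
  have := gaussUpper_nonneg (max w z)
  unfold steinSol
  positivity

lemma steinSol_le_min (z w : ℝ) :
    steinSol z w ≤ Real.exp (1 / 2 * w ^ 2) * gaussLower w ∧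
      steinSol z w ≤ Real.exp (1 / 2 * w ^ 2) * gaussUpper w := by
  have hI := gaussLower_mono (min_le_left w z)
  have hJ := gaussUpper_anti (le_max_left w z)
  have hI0 := gaussLower_nonneg (min w z)
  have hJ0 := gaussUpper_nonneg (max w z)
  have hs := gaussLower_add_gaussUpper (w := w)
  have hs0 := sqrt_two_pi_pos
  have he := Real.exp_pos (1 / 2 * w ^ 2)
  unfold steinSol
  constructor
  · rw [div_le_iff₀ hs0]
    calc _ ≤ Real.exp (1 / 2 * w ^ 2) * gaussLower w * √(2 * Real.pi) := by
          have hI1 := gaussLower_nonneg w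
          gcongr
          linarith
      _ = _ := rfl
  · rw [div_le_iff₀ hs0]
    have : gaussLower (min w z) ≤ √(2 * Real.pi) := by
      have := gaussUpper_nonneg w
      linarith
    calc _ ≤ Real.exp (1 / 2 * w ^ 2) * √(2 * Real.pi) * gaussUpper w := by gcongr
      _ = _ := by ring

lemma steinSol_le (z w : ℝ) : steinSol z w ≤ 2 := by
  obtain ⟨h1, h2⟩ := steinSol_le_min z w
  have he := Real.exp_pos (1 / 2 * w ^ 2)
  have hee := exp_mul_exp_neg w
  rcases le_total 0 w with hw | hw
  · have := mul_le_mul_of_nonneg_left (gaussUpper_le w hw) he.le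
    nlinarith
  · have h3 := gaussUpper_le (-w) (by linarith)
    rw [← gaussLower_eq_gaussUpper_neg, neg_sq] at h3
    have := mul_le_mul_of_nonneg_left h3 he.le
    nlinarith

lemma abs_mul_steinSol_le (z w : ℝ) : |w * steinSol z w| ≤ 1 := by
  obtain ⟨h1, h2⟩ := steinSol_le_min z w
  have he := Real.exp_pos (1 / 2 * w ^ 2)
  have hee := exp_mul_exp_neg w
  rw [abs_mul, abs_of_nonneg (steinSol_nonneg z w)]
  rcases le_total 0 w with hw | hw
  · rw [abs_of_nonneg hw]
    have h4 := mul_le_mul_of_nonneg_left h2 hw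
    have := mul_le_mul_of_nonneg_left (mul_gaussUpper_le w hw) he.le
    nlinarith
  · rw [abs_of_nonpos hw]
    have h3 := mul_gaussUpper_le (-w) (by linarith)
    rw [← gaussLower_eq_gaussUpper_neg, neg_sq] at h3
    have h4 := mul_le_mul_of_nonneg_left h1 (neg_nonneg.2 hw)
    have := mul_le_mul_of_nonneg_left h3 he.le
    nlinarith

lemma abs_steinDeriv_le (z w : ℝ) : |steinDeriv z w| ≤ 2 := by
  have h1 := abs_le.1 (abs_mul_steinSol_le z w)
  have h2 : (gaussianReal 0 1).real (Set.Iic z) ≤ 1 := measureReal_le_one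
  have h3 : 0 ≤ (gaussianReal 0 1).real (Set.Iic z) := measureReal_nonneg
  unfold steinDeriv
  rw [abs_le]
  by_cases hw : w ∈ Set.Iic z
  · rw [Set.indicator_of_mem hw]; constructor <;> linarith
  · rw [Set.indicator_of_notMem hw]; constructor <;> linarith

lemma hasDerivAt_steinSol {z w : ℝ} (hw : w ≠ z) :
    HasDerivAt (steinSol z) (steinDeriv z w) w := by
  have hs0 := sqrt_two_pi_pos.ne'
  have hee' : Real.exp (w ^ 2 / 2) * Real.exp (-(w ^ 2 / 2)) = 1 := by
    rw [← Real.exp_add]; simp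
  have hE : HasDerivAt (fun w : ℝ => Real.exp (1 / 2 * w ^ 2))
      (w * Real.exp (1 / 2 * w ^ 2)) w := by
    have h := ((hasDerivAt_pow 2 w).const_mul (1 / 2 : ℝ)).exp
    convert h using 1
    simp; ring
  have hP := gaussianReal_real_Iic z
  have hsum := gaussLower_add_gaussUpper (w := z)
  rcases lt_or_gt_of_ne hw with h | h
  · have hev : steinSol z =ᶠ[nhds w] fun w =>
        Real.exp (1 / 2 * w ^ 2) * gaussLower w * gaussUpper z / √(2 * Real.pi) := by
      filter_upwards [Iio_mem_nhds h] with u hu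
      have hu' : u < z := hu
      simp [steinSol, min_eq_left hu'.le, max_eq_right hu'.le]
    have hd := ((hE.mul (hasDerivAt_gaussLower w)).mul_const (gaussUpper z)).div_const
      √(2 * Real.pi)
    refine (hd.congr_of_eventuallyEq hev).congr_deriv ?_
    rw [steinDeriv, hev.self_of_nhds, Set.indicator_of_mem (show w ∈ Set.Iic z from h.le), hP]
    field_simp
    linear_combination (gaussUpper z) * hee' + hsum
  · have hev : steinSol z =ᶠ[nhds w] fun w =>
        Real.exp (1 / 2 * w ^ 2) * gaussLower z * gaussUpper w / √(2 * Real.pi) := by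
      filter_upwards [Ioi_mem_nhds h] with u hu
      have hu' : z < u := hu
      simp [steinSol, min_eq_right hu'.le, max_eq_left hu'.le]
    have hd := ((hE.mul_const (gaussLower z)).mul (hasDerivAt_gaussUpper w)).div_const
      √(2 * Real.pi)
    refine (hd.congr_of_eventuallyEq hev).congr_deriv ?_
    rw [steinDeriv, hev.self_of_nhds,
      Set.indicator_of_notMem (show w ∉ Set.Iic z from not_le.2 h), hP]
    field_simp
    linear_combination (-gaussLower z) * hee'

lemma intervalIntegrable_of_abs_le {g : ℝ → ℝ} (hg : Measurable g) {C : ℝ} (hC : ∀ x, |g x| ≤ C)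
    (a b : ℝ) : IntervalIntegrable g volume a b :=
  (intervalIntegrable_const (c := C)).mono_fun hg.aestronglyMeasurable
    (Filter.Eventually.of_forall fun x => by
      simpa [abs_of_nonneg ((abs_nonneg _).trans (hC x))] using hC x)

lemma integral_steinDeriv (z a b : ℝ) :
    ∫ x in a..b, steinDeriv z x = steinSol z b - steinSol z a :=
  integral_eq_of_hasDerivAt_off_countable _ _ (Set.countable_singleton z)
    (continuous_steinSol z).continuousOn (fun _ hx => hasDerivAt_steinSol hx.2)
    (intervalIntegrable_of_abs_le (measurable_steinDeriv z) (abs_steinDeriv_le z) a b)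

lemma abs_steinSol_sub_le (z a b : ℝ) : |steinSol z b - steinSol z a| ≤ 2 * |b - a| := by
  rw [← integral_steinDeriv]
  exact intervalIntegral.norm_integral_le_of_norm_le_const fun x _ =>
    (Real.norm_eq_abs _).le.trans (abs_steinDeriv_le z x)

/-! ### Replacing one summand in the Stein identity -/

lemma integrable_of_abs_le {α : Type*} [MeasurableSpace α] {m : Measure α} [IsFiniteMeasure m]
    {g : α → ℝ} (hg : AEStronglyMeasurable g m) {C : ℝ} (hC : ∀ x, |g x| ≤ C) : Integrable g m :=
  Integrable.of_bound hg C (Filter.Eventually.of_forall hC)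

lemma abs_mul_steinSol_sub_le (z v t u : ℝ) :
    |(v + t) * steinSol z (v + t) - (v + u) * steinSol z (v + u)| ≤
      (2 * |v| + 2) * (|t| + |u|) := by
  have e : (v + t) * steinSol z (v + t) - (v + u) * steinSol z (v + u) =
      v * (steinSol z (v + t) - steinSol z (v + u)) + t * steinSol z (v + t)
        - u * steinSol z (v + u) := by ring
  have h1 : |v * (steinSol z (v + t) - steinSol z (v + u))| ≤ |v| * (2 * (|t| + |u|)) := by
    rw [abs_mul]
    gcongr
    refine (abs_steinSol_sub_le z (v + u) (v + t)).trans ?_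
    have : v + t - (v + u) = t - u := by ring
    rw [this]
    linarith [abs_sub t u]
  have h2 : ∀ s : ℝ, |s * steinSol z (v + s)| ≤ 2 * |s| := fun s => by
    rw [abs_mul, abs_of_nonneg (steinSol_nonneg _ _), mul_comm]
    exact mul_le_mul_of_nonneg_right (steinSol_le _ _) (abs_nonneg _)
  rw [e]
  have h3 := abs_sub (v * (steinSol z (v + t) - steinSol z (v + u)) + t * steinSol z (v + t))
    (u * steinSol z (v + u))
  have h4 := abs_add_le (v * (steinSol z (v + t) - steinSol z (v + u))) (t * steinSol z (v + t))
  have h5 := h2 t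
  have h6 := h2 u
  nlinarith

/-- A measure that gives intervals of length `L` mass at most `a * L + c` has a distribution
function with the same modulus of continuity. -/
lemma abs_measureReal_Iic_sub_le {ν : Measure ℝ} [IsFiniteMeasure ν] {a c : ℝ}
    (hν : ∀ x y, x ≤ y → ν.real (Set.Icc x y) ≤ a * (y - x) + c) (x y : ℝ) :
    |ν.real (Set.Iic x) - ν.real (Set.Iic y)| ≤ a * |x - y| + c := by
  wlog h : y ≤ x generalizing x y
  · rw [abs_sub_comm, abs_sub_comm x]
    exact this y x (le_of_not_ge h)
  have h1 : ν.real (Set.Iic y) ≤ ν.real (Set.Iic x) := measureReal_mono (Set.Iic_subset_Iic.2 h)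
  have h2 : ν.real (Set.Iic x) ≤ ν.real (Set.Iic y) + ν.real (Set.Icc y x) := by
    refine (measureReal_mono ?_).trans (measureReal_union_le _ _)
    intro w hw
    rcases le_total w y with hwy | hwy
    · exact Or.inl hwy
    · exact Or.inr ⟨hwy, hw⟩
  rw [abs_of_nonneg (by linarith), abs_of_nonneg (by linarith)]
  linarith [hν y x h]

section

variable {ν : Measure ℝ} [IsProbabilityMeasure ν]

lemma integrable_steinDeriv_add (z t : ℝ) : Integrable (fun v => steinDeriv z (v + t)) ν :=
  integrable_of_abs_le ((measurable_steinDeriv z).comp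
    (measurable_id.add_const t)).aestronglyMeasurable fun _ => abs_steinDeriv_le _ _

lemma integrable_steinSol_add (z t : ℝ) : Integrable (fun v => steinSol z (v + t)) ν :=
  integrable_of_abs_le ((continuous_steinSol z).comp
    (continuous_id.add_const t)).aestronglyMeasurable fun _ => by
      rw [abs_of_nonneg (steinSol_nonneg _ _)]; exact steinSol_le _ _

/-- The averaged derivative `t ↦ E f'(V + t)` is nearly Lipschitz at the origin. The constant is
`21 / 4 = 4 + 5 / 4`: the smooth part of `f'` contributes `2 E|V| + 2 ≤ 4`, its jump at `z` the
slope `5 / 4` of the concentration inequality. -/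
lemma abs_integral_steinDeriv_sub_le (z : ℝ) {G : ℝ} (hid : Integrable (fun v : ℝ => |v|) ν)
    (h1 : ∫ v, |v| ∂ν ≤ 1)
    (hν : ∀ x y, x ≤ y → ν.real (Set.Icc x y) ≤ 5 / 4 * (y - x) + 5 / 2 * G) (t u : ℝ) :
    |∫ v, steinDeriv z (v + t) ∂ν - ∫ v, steinDeriv z (v + u) ∂ν| ≤
      21 / 4 * (|t| + |u|) + 5 / 2 * G := by
  set A : ℝ → ℝ := fun v => (v + t) * steinSol z (v + t) - (v + u) * steinSol z (v + u)
  have hA : ∀ v, |A v| ≤ (2 * |v| + 2) * (|t| + |u|) := fun v => abs_mul_steinSol_sub_le z v t u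
  have hAi : Integrable (fun v => (2 * |v| + 2) * (|t| + |u|)) ν :=
    ((hid.const_mul 2).add (integrable_const 2)).mul_const _
  have hAm : AEStronglyMeasurable A ν := by
    have := continuous_steinSol z
    exact Continuous.aestronglyMeasurable (by fun_prop)
  have hAint : Integrable A ν := hAi.mono' hAm (Filter.Eventually.of_forall hA)
  have hI : ∀ s, (fun v => (Set.Iic z).indicator (fun _ => (1 : ℝ)) (v + s)) =
      (Set.Iic (z - s)).indicator fun _ => (1 : ℝ) := fun s => by
    funext v
    by_cases h : v + s ≤ z
    · rw [Set.indicator_of_mem (show v + s ∈ Set.Iic z from h),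
        Set.indicator_of_mem (show v ∈ Set.Iic (z - s) by simp; linarith)]
    · rw [Set.indicator_of_notMem (show v + s ∉ Set.Iic z from h),
        Set.indicator_of_notMem (show v ∉ Set.Iic (z - s) by simp; linarith)]
  have hIi : ∀ s, Integrable ((Set.Iic s).indicator fun _ => (1 : ℝ)) ν := fun s =>
    (integrable_const 1).indicator measurableSet_Iic
  have hdec : ∀ v, steinDeriv z (v + t) - steinDeriv z (v + u) =
      A v + ((Set.Iic (z - t)).indicator (fun _ => (1 : ℝ)) v
        - (Set.Iic (z - u)).indicator (fun _ => (1 : ℝ)) v) := fun v => by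
    rw [← hI t, ← hI u]
    simp only [steinDeriv, A]
    ring
  rw [← integral_sub (integrable_steinDeriv_add z t) (integrable_steinDeriv_add z u)]
  simp only [hdec]
  have hIsub : Integrable (fun v => (Set.Iic (z - t)).indicator (fun _ => (1 : ℝ)) v
      - (Set.Iic (z - u)).indicator (fun _ => (1 : ℝ)) v) ν := (hIi _).sub (hIi _)
  rw [integral_add hAint hIsub, integral_sub (hIi _) (hIi _)]
  have hInd : ∀ s, ∫ v, (Set.Iic s).indicator (fun _ => (1 : ℝ)) v ∂ν = ν.real (Set.Iic s) :=
    fun s => integral_indicator_one measurableSet_Iic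
  rw [hInd, hInd]
  have hB := abs_measureReal_Iic_sub_le hν (z - t) (z - u)
  have e : z - t - (z - u) = u - t := by ring
  rw [e] at hB
  have hC : |∫ v, A v ∂ν| ≤ 4 * (|t| + |u|) := by
    refine abs_integral_le_integral_abs.trans ?_
    refine (integral_mono hAint.abs hAi hA).trans ?_
    rw [integral_mul_const, integral_add (hid.const_mul 2) (integrable_const 2),
      integral_const_mul, integral_const]
    simp only [probReal_univ, smul_eq_mul, one_mul]
    exact mul_le_mul_of_nonneg_right (by linarith) (by positivity)
  have hD := abs_add_le (∫ v, A v ∂ν) (ν.real (Set.Iic (z - t)) - ν.real (Set.Iic (z - u)))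
  have hE := abs_sub u t
  linarith

lemma measurable_integral_steinDeriv (z : ℝ) :
    StronglyMeasurable fun t => ∫ v, steinDeriv z (v + t) ∂ν := by
  have : StronglyMeasurable (Function.uncurry fun t v : ℝ => steinDeriv z (v + t)) :=
    ((measurable_steinDeriv z).comp (measurable_snd.add measurable_fst)).stronglyMeasurable
  exact this.integral_prod_right

lemma abs_integral_steinDeriv_le (z t : ℝ) : |∫ v, steinDeriv z (v + t) ∂ν| ≤ 2 := by
  have := norm_integral_le_of_norm_le_const (μ := ν) (f := fun v => steinDeriv z (v + t)) (C := 2)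
    (Filter.Eventually.of_forall fun v => abs_steinDeriv_le z _)
  simpa using this

lemma integral_steinSol_sub (z x : ℝ) :
    ∫ v, steinSol z (v + x) ∂ν - ∫ v, steinSol z v ∂ν =
      ∫ t in (0 : ℝ)..x, ∫ v, steinDeriv z (v + t) ∂ν := by
  have h0 := integrable_steinSol_add (ν := ν) z 0
  simp only [add_zero] at h0
  rw [intervalIntegral_integral_swap, ← integral_sub (integrable_steinSol_add z x) h0]
  · congr 1
    funext v
    have := integral_steinDeriv z v (v + x)
    rw [← this]
    simp [intervalIntegral.integral_comp_add_left (fun y => steinDeriv z y)]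
  · have : IsFiniteMeasure (volume.restrict (Set.uIoc 0 x)) := ⟨by simp [Set.uIoc]⟩
    refine integrable_of_abs_le (C := 2) ?_ fun p => abs_steinDeriv_le z _
    exact ((measurable_steinDeriv z).comp
      (measurable_snd.add measurable_fst)).aestronglyMeasurable

lemma measurable_integral_steinSol (z : ℝ) :
    StronglyMeasurable fun t => ∫ v, steinSol z (v + t) ∂ν := by
  have : StronglyMeasurable (Function.uncurry fun t v : ℝ => steinSol z (v + t)) :=
    ((continuous_steinSol z).comp (continuous_snd.add continuous_fst)).stronglyMeasurable
  exact this.integral_prod_right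

lemma abs_integral_steinSol_le (z t : ℝ) : |∫ v, steinSol z (v + t) ∂ν| ≤ 2 := by
  have := norm_integral_le_of_norm_le_const (μ := ν) (f := fun v => steinSol z (v + t)) (C := 2)
    (Filter.Eventually.of_forall fun v => by
      rw [Real.norm_eq_abs, abs_of_nonneg (steinSol_nonneg _ _)]; exact steinSol_le _ _)
  simpa using this

lemma abs_intervalIntegral_le_quadratic {g : ℝ → ℝ} {a b : ℝ}
    (hg : ∀ t, |g t| ≤ a * |t| + b) (x : ℝ) :
    |∫ t in (0 : ℝ)..x, g t| ≤ a * (x ^ 2 / 2) + b * |x| := by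
  have hi : ∀ p q, IntervalIntegrable (fun t : ℝ => a * |t| + b) volume p q := fun p q =>
    (by fun_prop : Continuous fun t : ℝ => a * |t| + b).intervalIntegrable _ _
  rcases le_total 0 x with hx | hx
  · have h := intervalIntegral.norm_integral_le_of_norm_le hx
      (Filter.Eventually.of_forall fun t _ => (Real.norm_eq_abs (g t)).le.trans (hg t)) (hi 0 x)
    have e : ∫ t in (0 : ℝ)..x, (a * |t| + b) = ∫ t in (0 : ℝ)..x, (a * t + b) :=
      intervalIntegral.integral_congr fun t ht => by
        rw [Set.uIcc_of_le hx] at ht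
        simp only [abs_of_nonneg ht.1]
    rw [e, intervalIntegral.integral_add (Continuous.intervalIntegrable (by fun_prop) _ _)
      (Continuous.intervalIntegrable (by fun_prop) _ _),
      intervalIntegral.integral_const_mul, integral_id, intervalIntegral.integral_const] at h
    rw [abs_of_nonneg hx]
    simp only [Real.norm_eq_abs, smul_eq_mul] at h
    linarith
  · have h := intervalIntegral.norm_integral_le_of_norm_le hx
      (Filter.Eventually.of_forall fun t _ => (Real.norm_eq_abs (g t)).le.trans (hg t)) (hi x 0)
    have e : ∫ t in x..(0 : ℝ), (a * |t| + b) = ∫ t in x..(0 : ℝ), (-a * t + b) :=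
      intervalIntegral.integral_congr fun t ht => by
        rw [Set.uIcc_of_le hx] at ht
        simp only [abs_of_nonpos ht.2, mul_neg, neg_mul]
    rw [e, intervalIntegral.integral_add (Continuous.intervalIntegrable (by fun_prop) _ _)
      (Continuous.intervalIntegrable (by fun_prop) _ _),
      intervalIntegral.integral_const_mul, integral_id, intervalIntegral.integral_const] at h
    rw [abs_of_nonpos hx, intervalIntegral.integral_symm, abs_neg]
    simp only [Real.norm_eq_abs, smul_eq_mul] at h
    linarith

/-- The contribution of one summand to the Stein identity. Here `ν` is the law of the sum of the
other summands and `μ` the law of the summand itself, so that `∫ t, ∫ v, g (v + t) ∂ν ∂μ` is the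
expectation of `g` at the full sum. -/
lemma abs_stein_summand_le (z : ℝ) {G : ℝ} (hid : Integrable (fun v : ℝ => |v|) ν)
    (h1 : ∫ v, |v| ∂ν ≤ 1)
    (hν : ∀ x y, x ≤ y → ν.real (Set.Icc x y) ≤ 5 / 4 * (y - x) + 5 / 2 * G)
    {μ : Measure ℝ} [IsProbabilityMeasure μ]
    (hm1 : Integrable (fun y : ℝ => y) μ) (hm2 : Integrable (fun y : ℝ => y ^ 2) μ)
    (hm3 : Integrable (fun y : ℝ => |y| ^ 3) μ) (h0 : ∫ y, y ∂μ = 0) :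
    |∫ y, y * ∫ v, steinSol z (v + y) ∂ν ∂μ
        - (∫ y, y ^ 2 ∂μ) * ∫ t, ∫ v, steinDeriv z (v + t) ∂ν ∂μ| ≤
      21 / 4 * ((∫ y, |y| ∂μ) * (∫ y, y ^ 2 ∂μ) + (∫ y, |y| ^ 3 ∂μ) / 2)
        + 5 / 2 * G * ∫ y, y ^ 2 ∂μ := by
  set h : ℝ → ℝ := fun t => ∫ v, steinDeriv z (v + t) ∂ν
  set F : ℝ → ℝ := fun t => ∫ v, steinSol z (v + t) ∂ν
  set D := ∫ t, h t ∂μ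
  set m1 := ∫ y, |y| ∂μ
  have hhint : Integrable h μ := integrable_of_abs_le
    (measurable_integral_steinDeriv z).aestronglyMeasurable (abs_integral_steinDeriv_le z)
  have hhD : ∀ t, |h t - D| ≤ 21 / 4 * |t| + (21 / 4 * m1 + 5 / 2 * G) := fun t => by
    have e : h t - D = ∫ u, (h t - h u) ∂μ := by
      rw [integral_sub (integrable_const _) hhint]; simp [D]
    rw [e]
    have hb0 : Integrable (fun u => |t| + |u|) μ := (integrable_const _).add hm1.abs
    have hb : Integrable (fun u => 21 / 4 * (|t| + |u|) + 5 / 2 * G) μ :=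
      (hb0.const_mul _).add (integrable_const _)
    refine abs_integral_le_integral_abs.trans ?_
    refine (integral_mono ((integrable_const _).sub hhint).abs hb
      fun u => abs_integral_steinDeriv_sub_le z hid h1 hν t u).trans (le_of_eq ?_)
    rw [integral_add (hb0.const_mul _) (integrable_const _),
      integral_const_mul, integral_add (integrable_const _) hm1.abs]
    simp [m1]; ring
  have hF : ∀ y, |y * F y - y * F 0 - y ^ 2 * D| ≤
      21 / 4 * (m1 * y ^ 2 + |y| ^ 3 / 2) + 5 / 2 * G * y ^ 2 := fun y => by
    have hF0 : F 0 = ∫ v, steinSol z v ∂ν := by simp [F]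
    have e : y * F y - y * F 0 - y ^ 2 * D = y * ∫ t in (0 : ℝ)..y, (h t - D) := by
      rw [intervalIntegral.integral_sub
        (intervalIntegrable_of_abs_le (measurable_integral_steinDeriv z).measurable
          (abs_integral_steinDeriv_le z) 0 y) (by simp), ← integral_steinSol_sub, hF0]
      simp [F]; ring
    rw [e, abs_mul]
    have := mul_le_mul_of_nonneg_left (abs_intervalIntegral_le_quadratic hhD y) (abs_nonneg y)
    refine this.trans (le_of_eq ?_)
    rw [← sq_abs y]; ring
  have hi1 : Integrable (fun y => y * F y) μ := hm1.mul_bdd (c := 2)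
    (measurable_integral_steinSol z).aestronglyMeasurable
    (Filter.Eventually.of_forall (abs_integral_steinSol_le z))
  have hi2 : Integrable (fun y => y * F y - y * F 0) μ := hi1.sub (hm1.mul_const _)
  have e : ∫ y, y * F y ∂μ - (∫ y, y ^ 2 ∂μ) * D =
      ∫ y, (y * F y - y * F 0 - y ^ 2 * D) ∂μ := by
    rw [integral_sub hi2 (hm2.mul_const _), integral_sub hi1 (hm1.mul_const _),
      integral_mul_const, integral_mul_const, h0]
    ring
  rw [e]
  have hb1 : Integrable (fun y => m1 * y ^ 2 + |y| ^ 3 / 2) μ :=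
    (hm2.const_mul _).add (hm3.div_const _)
  have hb : Integrable (fun y => 21 / 4 * (m1 * y ^ 2 + |y| ^ 3 / 2) + 5 / 2 * G * y ^ 2) μ :=
    (hb1.const_mul _).add (hm2.const_mul _)
  refine abs_integral_le_integral_abs.trans ((integral_mono (hi2.sub (hm2.mul_const _)).abs
    hb hF).trans (le_of_eq ?_))
  rw [integral_add (hb1.const_mul _) (hm2.const_mul _), integral_const_mul, integral_const_mul,
    integral_add (hm2.const_mul _) (hm3.div_const _), integral_const_mul, integral_div]

end

/-! ### A concentration inequality for sums of independent random variables -/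

/-- The identity centred at `m` and truncated at distance `c` from `m`. -/
def clamp (m c w : ℝ) : ℝ := max (-c) (min c (w - m))

lemma continuous_clamp (m c : ℝ) : Continuous (clamp m c) := by
  unfold clamp
  fun_prop

lemma abs_clamp_le {m c : ℝ} (hc : 0 ≤ c) (w : ℝ) : |clamp m c w| ≤ c :=
  abs_le.2 ⟨le_max_left _ _, max_le (by linarith) (min_le_left _ _)⟩

lemma clamp_mono (m c : ℝ) : Monotone (clamp m c) := fun _ _ h =>
  max_le_max_left _ (min_le_min_left _ (by linarith))

lemma mul_clamp_sub_nonneg (m c x v : ℝ) : 0 ≤ x * (clamp m c v - clamp m c (v - x)) := by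
  rcases le_total 0 x with hx | hx
  · have := clamp_mono m c (by linarith : v - x ≤ v)
    exact mul_nonneg hx (by linarith)
  · have := clamp_mono m c (by linarith : v ≤ v - x)
    exact mul_nonneg_of_nonpos_of_nonpos hx (by linarith)

lemma abs_mul_min_le_mul_clamp_sub {a b d : ℝ} (hd : 0 ≤ d) {v : ℝ} (hv : v ∈ Set.Icc a b)
    (x : ℝ) :
    |x| * min d |x| ≤
      x * (clamp ((a + b) / 2) ((b - a) / 2 + d) v
        - clamp ((a + b) / 2) ((b - a) / 2 + d) (v - x)) := by
  obtain ⟨h1, h2⟩ := hv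
  have e1 : clamp ((a + b) / 2) ((b - a) / 2 + d) v = v - (a + b) / 2 := by
    rw [clamp, min_eq_right (by linarith), max_eq_right (by linarith)]
  rw [e1]
  rcases le_total 0 x with hx | hx
  · rw [abs_of_nonneg hx]
    refine mul_le_mul_of_nonneg_left ?_ hx
    have h3 : clamp ((a + b) / 2) ((b - a) / 2 + d) (v - x) =
        max (-((b - a) / 2 + d)) (v - x - (a + b) / 2) := by
      rw [clamp, min_eq_right (a := (b - a) / 2 + d) (by linarith)]
    rw [h3]
    rcases le_total d x with h | h
    · rw [min_eq_left h]
      have : max (-((b - a) / 2 + d)) (v - x - (a + b) / 2) ≤ v - (a + b) / 2 - d :=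
        max_le (by linarith) (by linarith)
      linarith
    · rw [min_eq_right h]
      have : max (-((b - a) / 2 + d)) (v - x - (a + b) / 2) ≤ v - (a + b) / 2 - x :=
        max_le (by linarith) (by linarith)
      linarith
  · rw [abs_of_nonpos hx, neg_mul_comm]
    refine mul_le_mul_of_nonpos_left ?_ hx
    have h3 : clamp ((a + b) / 2) ((b - a) / 2 + d) (v - x) =
        min ((b - a) / 2 + d) (v - x - (a + b) / 2) :=
      max_eq_right (le_min (by linarith) (by linarith))
    rw [h3]
    rcases le_total d (-x) with h | h
    · rw [min_eq_left h]
      have : v - (a + b) / 2 + d ≤ min ((b - a) / 2 + d) (v - x - (a + b) / 2) :=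
        le_min (by linarith) (by linarith)
      linarith
    · rw [min_eq_right h]
      have : v - (a + b) / 2 - x ≤ min ((b - a) / 2 + d) (v - x - (a + b) / 2) :=
        le_min (by linarith) (by linarith)
      linarith

lemma memLp_abs_mul_min {Ω : Type*} [MeasurableSpace Ω] {P : Measure Ω} {X : Ω → ℝ}
    (hX : MemLp X 2 P) {d : ℝ} (hd : 0 ≤ d) :
    MemLp (fun ω => |X ω| * min d |X ω|) 2 P := by
  refine (hX.const_mul d).mono ?_ (Filter.Eventually.of_forall fun ω => ?_)
  · have hc : Continuous fun x : ℝ => |x| * min d |x| := by fun_prop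
    exact hc.comp_aestronglyMeasurable hX.1
  · have h1 : 0 ≤ min d |X ω| := le_min hd (abs_nonneg _)
    simp only [Real.norm_eq_abs, abs_mul, abs_abs, abs_of_nonneg h1, abs_of_nonneg hd]
    rw [mul_comm]
    gcongr
    exact min_le_left _ _

section

variable {Ω ι : Type*} [MeasurableSpace Ω] {P : Measure Ω} [IsProbabilityMeasure P]
  {ξ : ι → Ω → ℝ}

lemma integral_sq_sum_eq (hm : ∀ i, Measurable (ξ i)) (hind : iIndepFun ξ P)
    (h2 : ∀ i, MemLp (ξ i) 2 P) (h0 : ∀ i, ∫ ω, ξ i ω ∂P = 0) (s : Finset ι) :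
    ∫ ω, (∑ i ∈ s, ξ i ω) ^ 2 ∂P = ∑ i ∈ s, ∫ ω, ξ i ω ^ 2 ∂P := by
  have hvar := IndepFun.variance_sum (s := s) (fun i _ => h2 i)
    (fun i _ j _ hij => hind.indepFun hij)
  have hmean : ∫ ω, (∑ i ∈ s, ξ i) ω ∂P = 0 := by
    simp only [Finset.sum_apply]
    rw [integral_finsetSum _ fun i _ => (h2 i).integrable one_le_two]
    simp [h0]
  rw [variance_of_integral_eq_zero (Finset.aemeasurable_sum _ fun i _ => (hm i).aemeasurable)
    hmean] at hvar
  simp only [Finset.sum_apply] at hvar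
  rw [hvar]
  exact Finset.sum_congr rfl fun i _ => variance_of_integral_eq_zero (hm i).aemeasurable (h0 i)

lemma integral_abs_le_of_integral_sq_le {Y : Ω → ℝ} (hY : MemLp Y 2 P)
    {d : ℝ} (hd : 0 < d) (h : ∫ ω, Y ω ^ 2 ∂P ≤ d ^ 2) : ∫ ω, |Y ω| ∂P ≤ d := by
  have hb : ∀ ω, |Y ω| ≤ d / 2 + Y ω ^ 2 / (2 * d) := fun ω => by
    have : d / 2 + Y ω ^ 2 / (2 * d) - |Y ω| = (|Y ω| - d) ^ 2 / (2 * d) := by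
      rw [← sq_abs (Y ω)]; field_simp; ring
    have h2 : 0 ≤ (|Y ω| - d) ^ 2 / (2 * d) := by positivity
    linarith
  have hi : Integrable (fun ω => Y ω ^ 2 / (2 * d)) P := hY.integrable_sq.div_const _
  refine (integral_mono (hY.integrable one_le_two).abs ((integrable_const _).add hi) hb).trans ?_
  simp only [Pi.add_apply]
  rw [integral_add (integrable_const _) hi, integral_div (2 * d) (fun ω => Y ω ^ 2),
    integral_const]
  simp only [probReal_univ, smul_eq_mul, one_mul]
  have : (∫ ω, Y ω ^ 2 ∂P) / (2 * d) ≤ d ^ 2 / (2 * d) := by gcongr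
  have e : d ^ 2 / (2 * d) = d / 2 := by field_simp
  linarith

/-- The Chen–Shao concentration inequality, before the truncated moments on the left are estimated:
test the sum against a truncated identity, which has slope one on a `d`-neighbourhood of `[a, b]`. -/
lemma measureReal_Icc_mul_le [DecidableEq ι] (hm : ∀ i, Measurable (ξ i)) (hind : iIndepFun ξ P)
    (h2 : ∀ i, MemLp (ξ i) 2 P) (h0 : ∀ i, ∫ ω, ξ i ω ∂P = 0) (s : Finset ι)
    (hs : ∑ i ∈ s, ∫ ω, ξ i ω ^ 2 ∂P ≤ 1) {d : ℝ} (hd : 0 < d) {a b : ℝ} (hab : a ≤ b) :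
    P.real ((fun ω => ∑ i ∈ s, ξ i ω) ⁻¹' Set.Icc a b) *
        ∑ i ∈ s, ∫ ω, |ξ i ω| * min d |ξ i ω| ∂P ≤ (b - a) / 2 + 2 * d := by
  set c := (b - a) / 2 + d with hcdef
  have hc : 0 ≤ c := by rw [hcdef]; linarith
  set f := clamp ((a + b) / 2) c
  set V : Ω → ℝ := fun ω => ∑ i ∈ s, ξ i ω
  have hVm : Measurable V := Finset.measurable_sum _ fun i _ => hm i
  have hfc : Continuous f := continuous_clamp _ _
  set E := V ⁻¹' Set.Icc a b
  have hE : MeasurableSet E := hVm measurableSet_Icc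
  set h : ι → Ω → ℝ := fun i ω => |ξ i ω| * min d |ξ i ω|
  have hh2 : ∀ i, MemLp (h i) 2 P := fun i => memLp_abs_mul_min (h2 i) hd.le
  have hhi : ∀ i, Integrable (h i) P := fun i => (hh2 i).integrable one_le_two
  have hξi : ∀ i, Integrable (ξ i) P := fun i => (h2 i).integrable one_le_two
  have hint : ∀ i (g : Ω → ℝ), Measurable g → Integrable (fun ω => ξ i ω * f (g ω)) P :=
    fun i g hg => (hξi i).mul_bdd (c := c) (hfc.measurable.comp hg).aestronglyMeasurable
      (Filter.Eventually.of_forall fun ω => abs_clamp_le hc _)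
  have hV2 : MemLp V 2 P := memLp_finsetSum s fun i _ => h2 i
  -- Upper bound for `E V f(V)`.
  have hup : ∫ ω, V ω * f (V ω) ∂P ≤ c := by
    have hV1 : ∫ ω, |V ω| ∂P ≤ 1 := by
      refine integral_abs_le_of_integral_sq_le hV2 one_pos ?_
      rw [integral_sq_sum_eq hm hind h2 h0]; simpa using hs
    calc ∫ ω, V ω * f (V ω) ∂P ≤ ∫ ω, |V ω| * c ∂P := by
          refine integral_mono ((hV2.integrable one_le_two).mul_bdd (c := c)
            (hfc.measurable.comp hVm).aestronglyMeasurable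
            (Filter.Eventually.of_forall fun ω => abs_clamp_le hc _))
            ((hV2.integrable one_le_two).abs.mul_const _) fun ω => ?_
          refine (le_abs_self _).trans ?_
          simp only [abs_mul]
          gcongr
          exact abs_clamp_le hc _
      _ ≤ c := by
          rw [integral_mul_const]
          nlinarith
  -- Each summand sees only the increment of `f` it causes, by independence.
  have hterm : ∀ i ∈ s, ∫ ω, ξ i ω * f (V ω) ∂P =
      ∫ ω, ξ i ω * (f (V ω) - f (V ω - ξ i ω)) ∂P := by
    intro i hi
    have hsplit : ∀ ω, V ω - ξ i ω = (∑ j ∈ s.erase i, ξ j) ω := fun ω => by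
      simp only [V, Finset.sum_apply, ← Finset.add_sum_erase s (fun j => ξ j ω) hi]; ring
    have hindi : IndepFun (ξ i) (fun ω => f (V ω - ξ i ω)) P := by
      simp only [hsplit]
      exact ((hind.indepFun_finsetSum_of_notMem hm (Finset.notMem_erase i s)).symm).comp
        measurable_id hfc.measurable
    have hz : ∫ ω, ξ i ω * f (V ω - ξ i ω) ∂P = 0 := by
      rw [hindi.integral_fun_mul_eq_mul_integral (hm i).aestronglyMeasurable
        (hfc.measurable.comp (hVm.sub (hm i))).aestronglyMeasurable, h0, zero_mul]
    simp only [mul_sub]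
    rw [integral_sub (hint i V hVm) (hint i (fun ω => V ω - ξ i ω) (hVm.sub (hm i))), hz,
      sub_zero]
  have hlow : ∫ ω in E, ∑ i ∈ s, h i ω ∂P ≤ c := by
    refine le_trans ?_ hup
    have e : ∫ ω, V ω * f (V ω) ∂P =
        ∫ ω, ∑ i ∈ s, ξ i ω * (f (V ω) - f (V ω - ξ i ω)) ∂P := by
      have hi' : ∀ i ∈ s, Integrable (fun ω => ξ i ω * (f (V ω) - f (V ω - ξ i ω))) P :=
        fun i _ => by
          simp only [mul_sub]
          exact (hint i V hVm).sub (hint i _ (hVm.sub (hm i)))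
      rw [integral_finsetSum _ hi']
      simp only [V, Finset.sum_mul]
      rw [integral_finsetSum _ fun i _ => hint i V hVm]
      exact Finset.sum_congr rfl hterm
    rw [e, ← integral_indicator hE]
    refine integral_mono ((integrable_finsetSum _ fun i _ => hhi i).indicator hE)
      (integrable_finsetSum _ fun i _ => ?_) fun ω => ?_
    · simp only [mul_sub]
      exact (hint i V hVm).sub (hint i _ (hVm.sub (hm i)))
    · by_cases hω : ω ∈ E
      · rw [Set.indicator_of_mem hω]
        exact Finset.sum_le_sum fun i _ => abs_mul_min_le_mul_clamp_sub hd.le hω _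
      · rw [Set.indicator_of_notMem hω]
        exact Finset.sum_nonneg fun i _ => mul_clamp_sub_nonneg _ _ _ _
  -- The sum `H` of the `h i` is close to its mean, so the indicator of `E` can be split off.
  set H : Ω → ℝ := ∑ i ∈ s, h i
  have hH2 : MemLp H 2 P := memLp_finsetSum' s fun i _ => hh2 i
  have hHi : Integrable H P := hH2.integrable one_le_two
  have hHmean : ∫ ω, H ω ∂P = ∑ i ∈ s, ∫ ω, h i ω ∂P := by
    simp only [H, Finset.sum_apply]
    exact integral_finsetSum _ fun i _ => hhi i
  have hHvar : variance H P ≤ d ^ 2 := by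
    have hhind : iIndepFun h P := hind.comp (fun _ x => |x| * min d |x|) fun _ =>
      (by fun_prop : Continuous fun x : ℝ => |x| * min d |x|).measurable
    rw [IndepFun.variance_sum (fun i _ => hh2 i) fun i _ j _ hij => hhind.indepFun hij]
    calc ∑ i ∈ s, variance (h i) P ≤ ∑ i ∈ s, d ^ 2 * ∫ ω, ξ i ω ^ 2 ∂P := by
          refine Finset.sum_le_sum fun i _ => ?_
          refine (variance_le_expectation_sq (hh2 i).1).trans ?_
          rw [← integral_const_mul]
          refine integral_mono (hh2 i).integrable_sq ((h2 i).integrable_sq.const_mul _)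
            fun ω => ?_
          have h1 : 0 ≤ min d |ξ i ω| := le_min hd.le (abs_nonneg _)
          have h3 : min d |ξ i ω| ≤ d := min_le_left _ _
          simp only [Pi.pow_apply, h, mul_pow, sq_abs]
          rw [mul_comm]
          gcongr
      _ ≤ d ^ 2 := by
          rw [← Finset.mul_sum]
          nlinarith [sq_nonneg d]
  have hdev : ∫ ω, |H ω - ∫ ω', H ω' ∂P| ∂P ≤ d := by
    refine integral_abs_le_of_integral_sq_le (hH2.sub (memLp_const _)) hd ?_
    rw [variance_eq_integral hH2.1.aemeasurable] at hHvar
    exact hHvar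
  have hsub : P.real E * ∫ ω, H ω ∂P - ∫ ω in E, H ω ∂P ≤ d := by
    refine le_trans ?_ hdev
    have hconst : P.real E * ∫ ω, H ω ∂P = ∫ _ in E, (∫ ω', H ω' ∂P) ∂P := by
      rw [setIntegral_const, smul_eq_mul]
    rw [hconst, ← integral_sub (integrable_const _) hHi.integrableOn]
    calc _ ≤ ∫ ω in E, |H ω - ∫ ω', H ω' ∂P| ∂P := by
          refine integral_mono ((integrable_const _).sub hHi.integrableOn)
            (hHi.integrableOn.sub (integrable_const _)).abs fun ω => ?_
          rw [abs_sub_comm]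
          exact le_abs_self _
      _ ≤ _ := setIntegral_le_integral (hHi.sub (integrable_const _)).abs
          (Filter.Eventually.of_forall fun ω => abs_nonneg _)
  have hHE : ∫ ω in E, H ω ∂P = ∫ ω in E, ∑ i ∈ s, h i ω ∂P := by simp [H]
  rw [← hHmean]
  linarith

end

/-! ### The Berry–Esseen bound -/

lemma integral_comp_eq_of_indepFun {Ω : Type*} [MeasurableSpace Ω] {P : Measure Ω}
    [IsProbabilityMeasure P] {X Y : Ω → ℝ} (hX : Measurable X) (hY : Measurable Y)
    (h : IndepFun X Y P) {g : ℝ → ℝ → ℝ} (hg : Measurable (Function.uncurry g))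
    (hi : Integrable (fun ω => g (X ω) (Y ω)) P) :
    ∫ ω, g (X ω) (Y ω) ∂P = ∫ x, ∫ y, g x y ∂P.map Y ∂P.map X := by
  have hXY : Measurable fun ω => (X ω, Y ω) := hX.prodMk hY
  have hmap := (indepFun_iff_map_prod_eq_prod_map_map hX.aemeasurable hY.aemeasurable).1 h
  have hi' : Integrable (Function.uncurry g) ((P.map X).prod (P.map Y)) := by
    rw [← hmap, integrable_map_measure hg.aestronglyMeasurable hXY.aemeasurable]
    exact hi
  have : IsProbabilityMeasure (P.map X) := Measure.isProbabilityMeasure_map hX.aemeasurable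
  have : IsProbabilityMeasure (P.map Y) := Measure.isProbabilityMeasure_map hY.aemeasurable
  rw [integral_integral hi', ← hmap, integral_map hXY.aemeasurable]
  exact hg.aestronglyMeasurable

lemma sq_sub_le_abs_mul_min {d : ℝ} (hd : 0 < d) (x : ℝ) :
    x ^ 2 - |x| ^ 3 / (4 * d) ≤ |x| * min d |x| := by
  rw [← sq_abs x]
  have hx := abs_nonneg x
  rcases le_total |x| d with h | h
  · rw [min_eq_right h]
    have : 0 ≤ |x| ^ 3 / (4 * d) := by positivity
    nlinarith
  · rw [min_eq_left h]
    have e : |x| * d - (|x| ^ 2 - |x| ^ 3 / (4 * d)) = |x| * (|x| - 2 * d) ^ 2 / (4 * d) := by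
      field_simp; ring
    have : 0 ≤ |x| * (|x| - 2 * d) ^ 2 / (4 * d) := by positivity
    linarith

lemma integrable_abs_pow_three {Ω : Type*} [MeasurableSpace Ω] {P : Measure Ω} {X : Ω → ℝ}
    (hX : MemLp X 3 P) : Integrable (fun ω => |X ω| ^ 3) P := by
  simpa using hX.integrable_norm_pow (p := 3) (by norm_num)

lemma sum_integral_abs_pow_three_pos {Ω ι : Type*} [MeasurableSpace Ω] {P : Measure Ω}
    {ξ : ι → Ω → ℝ} [Fintype ι] (h3 : ∀ i, MemLp (ξ i) 3 P)
    (hvar : ∑ i, ∫ ω, ξ i ω ^ 2 ∂P = 1) : 0 < ∑ i, ∫ ω, |ξ i ω| ^ 3 ∂P := by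
  have hnn : ∀ i, 0 ≤ ∫ ω, |ξ i ω| ^ 3 ∂P := fun i => integral_nonneg fun ω => by positivity
  refine lt_of_le_of_ne (Finset.sum_nonneg fun i _ => hnn i) fun h => ?_
  have hz := (Finset.sum_eq_zero_iff_of_nonneg fun i _ => hnn i).1 h.symm
  have : ∑ i, ∫ ω, ξ i ω ^ 2 ∂P = 0 := by
    refine Finset.sum_eq_zero fun i hi => ?_
    have h1 := (integral_eq_zero_iff_of_nonneg (fun ω => by positivity)
      (integrable_abs_pow_three (h3 i))).1 (hz i hi)
    refine integral_eq_zero_of_ae ?_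
    filter_upwards [h1] with ω hω
    have : |ξ i ω| = 0 := by simpa using hω
    simp [abs_eq_zero.1 this]
  rw [this] at hvar
  exact zero_ne_one hvar

section

variable {Ω ι : Type*} [MeasurableSpace Ω] {P : Measure Ω} [IsProbabilityMeasure P]
  {ξ : ι → Ω → ℝ} [Fintype ι] [DecidableEq ι]

/-- With one summand left out, the concentration inequality still holds: the missing truncated
moment is at most `γ / 2 ≤ 1 / 11`, while all of them add up to at least `1 / 2`. -/
lemma measureReal_sum_erase_Icc_le (hm : ∀ i, Measurable (ξ i)) (hind : iIndepFun ξ P)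
    (h3 : ∀ i, MemLp (ξ i) 3 P) (h0 : ∀ i, ∫ ω, ξ i ω ∂P = 0)
    (hvar : ∑ i, ∫ ω, ξ i ω ^ 2 ∂P = 1) (hγ : ∑ i, ∫ ω, |ξ i ω| ^ 3 ∂P ≤ 2 / 11) (i : ι)
    {a b : ℝ} (hab : a ≤ b) :
    P.real ((fun ω => ∑ j ∈ Finset.univ.erase i, ξ j ω) ⁻¹' Set.Icc a b) ≤
      5 / 4 * (b - a) + 5 / 2 * ∑ i, ∫ ω, |ξ i ω| ^ 3 ∂P := by
  have h2 : ∀ i, MemLp (ξ i) 2 P := fun i => (h3 i).mono_exponent (by norm_num)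
  have hpos := sum_integral_abs_pow_three_pos h3 hvar
  set γ := ∑ i, ∫ ω, |ξ i ω| ^ 3 ∂P
  have hd : 0 < γ / 2 := by positivity
  have hsq0 : ∀ i, 0 ≤ ∫ ω, ξ i ω ^ 2 ∂P := fun i => integral_nonneg fun ω => sq_nonneg _
  have hs : ∑ j ∈ Finset.univ.erase i, ∫ ω, ξ j ω ^ 2 ∂P ≤ 1 := by
    rw [← hvar]
    exact Finset.sum_le_sum_of_subset_of_nonneg (Finset.erase_subset _ _) fun j _ _ => hsq0 j
  have hconc := measureReal_Icc_mul_le hm hind h2 h0 (Finset.univ.erase i) hs hd hab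
  have hhi : ∀ i, Integrable (fun ω => |ξ i ω| * min (γ / 2) |ξ i ω|) P := fun i =>
    (memLp_abs_mul_min (h2 i) hd.le).integrable one_le_two
  -- The choice `d = γ / 2` makes the loss `γ / (4 d)` equal to one half.
  have htot : 1 / 2 ≤ ∑ j, ∫ ω, |ξ j ω| * min (γ / 2) |ξ j ω| ∂P := by
    have h1 : ∀ j, ∫ ω, ξ j ω ^ 2 ∂P - (∫ ω, |ξ j ω| ^ 3 ∂P) / (4 * (γ / 2)) ≤
        ∫ ω, |ξ j ω| * min (γ / 2) |ξ j ω| ∂P := fun j => by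
      have hi3 := (integrable_abs_pow_three (h3 j)).div_const (4 * (γ / 2))
      rw [← integral_div, ← integral_sub (h2 j).integrable_sq hi3]
      exact integral_mono ((h2 j).integrable_sq.sub hi3) (hhi j)
        fun ω => sq_sub_le_abs_mul_min hd _
    refine le_trans (le_of_eq ?_) (Finset.sum_le_sum fun j _ => h1 j)
    rw [Finset.sum_sub_distrib, hvar, ← Finset.sum_div]
    change (1 : ℝ) / 2 = 1 - γ / (4 * (γ / 2))
    field_simp
    norm_num
  have hone : ∫ ω, |ξ i ω| * min (γ / 2) |ξ i ω| ∂P ≤ γ / 2 := by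
    have h1 : ∫ ω, |ξ i ω| ∂P ≤ 1 := by
      refine integral_abs_le_of_integral_sq_le (h2 i) one_pos ?_
      rw [one_pow, ← hvar]
      exact Finset.single_le_sum (fun j _ => hsq0 j) (Finset.mem_univ i)
    have h4 : ∫ ω, |ξ i ω| * min (γ / 2) |ξ i ω| ∂P ≤ ∫ ω, |ξ i ω| * (γ / 2) ∂P :=
      integral_mono (hhi i) (((h2 i).integrable one_le_two).abs.mul_const _) fun ω =>
        mul_le_mul_of_nonneg_left (min_le_left _ _) (abs_nonneg _)
    rw [integral_mul_const] at h4
    nlinarith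
  rw [← Finset.add_sum_erase _ _ (Finset.mem_univ i)] at htot
  have hp : 0 ≤ P.real ((fun ω => ∑ j ∈ Finset.univ.erase i, ξ j ω) ⁻¹' Set.Icc a b) :=
    measureReal_nonneg
  have h5 := mul_le_mul_of_nonneg_left
    (by linarith : (2 / 5 : ℝ) ≤
      ∑ j ∈ Finset.univ.erase i, ∫ ω, |ξ j ω| * min (γ / 2) |ξ j ω| ∂P) hp
  linarith

/-- **Berry–Esseen bound** for sums of independent, not necessarily identically distributed random
variables with total variance one. The products `E|ξ i| * E(ξ i)²` are kept apart from the third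
absolute moments: for the increments of a random measure over a fine partition they are of
smaller order away from the fixed atoms. -/
theorem abs_measureReal_sum_Iic_sub_gaussian_le (hm : ∀ i, Measurable (ξ i))
    (hind : iIndepFun ξ P) (h3 : ∀ i, MemLp (ξ i) 3 P) (h0 : ∀ i, ∫ ω, ξ i ω ∂P = 0)
    (hvar : ∑ i, ∫ ω, ξ i ω ^ 2 ∂P = 1) (z : ℝ) :
    |P.real ((fun ω => ∑ i, ξ i ω) ⁻¹' Set.Iic z) - (gaussianReal 0 1).real (Set.Iic z)| ≤
      11 / 2 * ∑ i, ∫ ω, |ξ i ω| ^ 3 ∂P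
        + 10 * ∑ i, (∫ ω, |ξ i ω| ∂P) * ∫ ω, ξ i ω ^ 2 ∂P := by
  have hpos := sum_integral_abs_pow_three_pos h3 hvar
  have hδ0 : ∀ i, 0 ≤ (∫ ω, |ξ i ω| ∂P) * ∫ ω, ξ i ω ^ 2 ∂P := fun i =>
    mul_nonneg (integral_nonneg fun ω => abs_nonneg _) (integral_nonneg fun ω => sq_nonneg _)
  have hδ : 0 ≤ ∑ i, (∫ ω, |ξ i ω| ∂P) * ∫ ω, ξ i ω ^ 2 ∂P := Finset.sum_nonneg fun i _ => hδ0 i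
  -- If the third moments are large, the bound exceeds one.
  rcases lt_or_ge (2 / 11) (∑ i, ∫ ω, |ξ i ω| ^ 3 ∂P) with hγ | hγ
  · have b1 : P.real ((fun ω => ∑ i, ξ i ω) ⁻¹' Set.Iic z) ≤ 1 := measureReal_le_one
    have b2 : 0 ≤ P.real ((fun ω => ∑ i, ξ i ω) ⁻¹' Set.Iic z) := measureReal_nonneg
    have b3 : (gaussianReal 0 1).real (Set.Iic z) ≤ 1 := measureReal_le_one
    have b4 : 0 ≤ (gaussianReal 0 1).real (Set.Iic z) := measureReal_nonneg
    rw [abs_le]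
    constructor <;> linarith
  have h2 : ∀ i, MemLp (ξ i) 2 P := fun i => (h3 i).mono_exponent (by norm_num)
  have hξi : ∀ i, Integrable (ξ i) P := fun i => (h2 i).integrable one_le_two
  set γ := ∑ i, ∫ ω, |ξ i ω| ^ 3 ∂P with hγdef
  set W : Ω → ℝ := fun ω => ∑ i, ξ i ω
  have hWm : Measurable W := Finset.measurable_sum _ fun i _ => hm i
  have hfm : Measurable (steinSol z) := (continuous_steinSol z).measurable
  set D := ∫ ω, steinDeriv z (W ω) ∂P
  have hfi : ∀ i, Integrable (fun ω => ξ i ω * steinSol z (W ω)) P := fun i =>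
    (hξi i).mul_bdd (c := 2) (hfm.comp hWm).aestronglyMeasurable
      (Filter.Eventually.of_forall fun ω => by
        rw [Real.norm_eq_abs, abs_of_nonneg (steinSol_nonneg _ _)]; exact steinSol_le _ _)
  have hDi : Integrable (fun ω => steinDeriv z (W ω)) P :=
    integrable_of_abs_le ((measurable_steinDeriv z).comp hWm).aestronglyMeasurable
      fun _ => abs_steinDeriv_le _ _
  have hterm : ∀ i, |∫ ω, ξ i ω * steinSol z (W ω) ∂P - (∫ ω, ξ i ω ^ 2 ∂P) * D| ≤
      21 / 4 * ((∫ ω, |ξ i ω| ∂P) * (∫ ω, ξ i ω ^ 2 ∂P) + (∫ ω, |ξ i ω| ^ 3 ∂P) / 2)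
        + 5 / 2 * γ * ∫ ω, ξ i ω ^ 2 ∂P := by
    intro i
    set V : Ω → ℝ := fun ω => ∑ j ∈ Finset.univ.erase i, ξ j ω
    have hVm : Measurable V := Finset.measurable_sum _ fun j _ => hm j
    have hW : ∀ ω, W ω = V ω + ξ i ω := fun ω => by
      simp only [W, V]
      rw [← Finset.add_sum_erase _ (fun j => ξ j ω) (Finset.mem_univ i)]; ring
    have hV2 : MemLp V 2 P := memLp_finsetSum _ fun j _ => h2 j
    have hVind : IndepFun (ξ i) V P := by
      have := (hind.indepFun_finsetSum_of_notMem hm (Finset.notMem_erase i Finset.univ)).symm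
      convert this using 1
      funext ω
      simp [V]
    have : IsProbabilityMeasure (P.map V) := Measure.isProbabilityMeasure_map hVm.aemeasurable
    have : IsProbabilityMeasure (P.map (ξ i)) :=
      Measure.isProbabilityMeasure_map (hm i).aemeasurable
    have hVabs : ∫ ω, |V ω| ∂P ≤ 1 := by
      refine integral_abs_le_of_integral_sq_le hV2 one_pos ?_
      rw [integral_sq_sum_eq hm hind h2 h0, one_pow, ← hvar]
      exact Finset.sum_le_sum_of_subset_of_nonneg (Finset.erase_subset _ _)
        fun j _ _ => integral_nonneg fun ω => sq_nonneg _
    have tr : ∀ {g : ℝ → ℝ}, Continuous g → ∫ y, g y ∂P.map (ξ i) = ∫ ω, g (ξ i ω) ∂P :=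
      fun hg => integral_map (hm i).aemeasurable hg.aestronglyMeasurable
    have tri : ∀ {g : ℝ → ℝ}, Continuous g → Integrable (fun ω => g (ξ i ω)) P →
        Integrable g (P.map (ξ i)) := fun hg h =>
      (integrable_map_measure hg.aestronglyMeasurable (hm i).aemeasurable).2 h
    have key := abs_stein_summand_le z (ν := P.map V) (μ := P.map (ξ i)) (G := γ)
      ((integrable_map_measure continuous_abs.aestronglyMeasurable hVm.aemeasurable).2
        (hV2.integrable one_le_two).abs)
      (by rw [integral_map hVm.aemeasurable continuous_abs.aestronglyMeasurable]; exact hVabs)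
      (fun x y hxy => by
        rw [map_measureReal_apply hVm measurableSet_Icc]
        exact measureReal_sum_erase_Icc_le hm hind h3 h0 hvar hγ i hxy)
      (tri continuous_id (hξi i)) (tri (continuous_pow 2) (h2 i).integrable_sq)
      (tri (continuous_abs.pow 3) (integrable_abs_pow_three (h3 i)))
      ((tr continuous_id).trans (h0 i))
    rw [tr (continuous_pow 2), tr continuous_abs,
      tr (g := fun y => |y| ^ 3) (continuous_abs.pow 3)] at key
    have e1 : ∫ ω, ξ i ω * steinSol z (W ω) ∂P =
        ∫ y, y * ∫ v, steinSol z (v + y) ∂P.map V ∂P.map (ξ i) := by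
      have := integral_comp_eq_of_indepFun (hm i) hVm hVind
        (g := fun y v => y * steinSol z (v + y))
        (measurable_fst.mul (hfm.comp (measurable_snd.add measurable_fst)))
        (by simpa only [hW] using hfi i)
      simp only [integral_const_mul] at this
      simp only [hW]
      exact this
    have e2 : D = ∫ y, ∫ v, steinDeriv z (v + y) ∂P.map V ∂P.map (ξ i) := by
      have := integral_comp_eq_of_indepFun (hm i) hVm hVind
        (g := fun y v => steinDeriv z (v + y))
        ((measurable_steinDeriv z).comp (measurable_snd.add measurable_fst))
        (by simpa only [hW] using hDi)
      simp only [D, hW]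
      exact this
    rw [e1, e2]
    exact key
  have hmain : P.real (W ⁻¹' Set.Iic z) - (gaussianReal 0 1).real (Set.Iic z) =
      -∑ i, (∫ ω, ξ i ω * steinSol z (W ω) ∂P - (∫ ω, ξ i ω ^ 2 ∂P) * D) := by
    rw [Finset.sum_sub_distrib, ← Finset.sum_mul, hvar, one_mul, ← integral_finsetSum _
      fun i _ => hfi i]
    have e : ∀ ω, steinDeriv z (W ω) = ∑ i, ξ i ω * steinSol z (W ω)
        + (W ⁻¹' Set.Iic z).indicator (fun _ => (1 : ℝ)) ω
        - (gaussianReal 0 1).real (Set.Iic z) := fun ω => by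
      rw [← Finset.sum_mul]
      rfl
    have hii : Integrable ((W ⁻¹' Set.Iic z).indicator fun _ => (1 : ℝ)) P :=
      (integrable_const _).indicator (hWm measurableSet_Iic)
    have hsi : Integrable (fun ω => ∑ i, ξ i ω * steinSol z (W ω)) P :=
      integrable_finsetSum _ fun i _ => hfi i
    have hone : ∫ ω, (W ⁻¹' Set.Iic z).indicator (fun _ => (1 : ℝ)) ω ∂P =
        P.real (W ⁻¹' Set.Iic z) := integral_indicator_one (hWm measurableSet_Iic)
    simp only [D, e]
    have hsum : Integrable (fun ω => ∑ i, ξ i ω * steinSol z (W ω)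
        + (W ⁻¹' Set.Iic z).indicator (fun _ => (1 : ℝ)) ω) P := hsi.add hii
    rw [integral_sub hsum (integrable_const _), integral_add hsi hii, hone]
    simp only [integral_const, probReal_univ, smul_eq_mul, one_mul]
    ring
  rw [hmain, abs_neg]
  refine (Finset.abs_sum_le_sum_abs _ _).trans ((Finset.sum_le_sum fun i _ => hterm i).trans ?_)
  rw [Finset.sum_add_distrib, ← Finset.mul_sum, ← Finset.mul_sum, hvar, Finset.sum_add_distrib,
    ← Finset.sum_div, ← hγdef]
  linarith

end

/-! ### Sums over fine partitions converge to sums over atoms -/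

section

variable {Γ : Type*} [MeasurableSpace Γ] [MeasurableSpace.CountablyGenerated Γ]

/-- Membership of a point in the first `n` sets of a sequence generating the σ-algebra. Its fibres
are a finite measurable partition of `Γ` that becomes finer as `n` grows. -/
noncomputable def cellIndex (n : ℕ) (x : Γ) : Fin n → Bool :=
  fun i => MeasurableSpace.mapNatBool Γ x i

/-- The cell with index `s` of the `n`-th partition. -/
def cell (n : ℕ) (s : Fin n → Bool) : Set Γ := cellIndex n ⁻¹' {s}

lemma measurable_cellIndex (n : ℕ) : Measurable (cellIndex (Γ := Γ) n) := by
  refine measurable_pi_iff.2 fun i => ?_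
  exact (measurable_pi_iff.1 (MeasurableSpace.measurable_mapNatBool Γ)) _

lemma measurableSet_cell (n : ℕ) (s : Fin n → Bool) : MeasurableSet (cell (Γ := Γ) n s) :=
  measurable_cellIndex n (measurableSet_singleton s)

lemma pairwise_disjoint_cell (n : ℕ) :
    Pairwise (Function.onFun Disjoint (cell (Γ := Γ) n)) := fun _ _ h =>
  Disjoint.preimage _ (Set.disjoint_singleton.2 h)

lemma antitone_cell (x : Γ) : Antitone fun n : ℕ => cell (Γ := Γ) n (cellIndex n x) := by
  intro m n hmn y hy
  have hy' : cellIndex n y = cellIndex n x := hy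
  change cellIndex m y = cellIndex m x
  funext i
  exact congrFun hy' (Fin.castLE hmn i)

lemma iInter_cell [MeasurableSingletonClass Γ] (x : Γ) :
    ⋂ n, cell n (cellIndex n x) = {x} := by
  ext y
  simp only [Set.mem_iInter, Set.mem_singleton_iff]
  refine ⟨fun h => ?_, fun h n => by rw [h]; rfl⟩
  refine MeasurableSpace.injective_mapNatBool Γ (funext fun n => ?_)
  have hy' : cellIndex (n + 1) y = cellIndex (n + 1) x := h (n + 1)
  exact congrFun hy' (Fin.last n)

lemma tendsto_measure_cell [MeasurableSingletonClass Γ] {ν : Measure Γ} (hν : ν Set.univ ≠ ∞)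
    (x : Γ) :
    Filter.Tendsto (fun n => ν (cell n (cellIndex n x))) Filter.atTop (nhds (ν {x})) := by
  rw [← iInter_cell x]
  exact tendsto_measure_iInter_atTop (fun n => (measurableSet_cell n _).nullMeasurableSet)
    (antitone_cell x) ⟨0, ne_top_of_le_ne_top hν (measure_mono (Set.subset_univ _))⟩

lemma sum_measure_cell (ν : Measure Γ) (n : ℕ) : ∑ s, ν (cell n s) = ν Set.univ := by
  rw [← measure_biUnion_finset (fun s _ t _ h => pairwise_disjoint_cell n h)
    fun s _ => measurableSet_cell n s]
  congr 1
  ext x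
  simp [cell]

lemma sum_mul_measure_cell (μ : Measure Γ) (n : ℕ) (g : (Fin n → Bool) → ℝ≥0∞) :
    ∑ s, g s * μ (cell n s) = ∫⁻ x, g (cellIndex n x) ∂μ := by
  rw [← lintegral_map (f := g) (measurable_of_finite g) (measurable_cellIndex n),
    lintegral_fintype]
  refine Finset.sum_congr rfl fun s _ => ?_
  rw [Measure.map_apply (measurable_cellIndex n) (measurableSet_singleton s)]
  rfl

lemma lintegral_eq_tsum_singleton {Γ : Type*} [MeasurableSpace Γ] [MeasurableSingletonClass Γ]
    (μ : Measure Γ) [IsFiniteMeasure μ] {g : Γ → ℝ≥0∞} (hg : ∀ x, μ {x} = 0 → g x = 0) :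
    ∫⁻ x, g x ∂μ = ∑' x, g x * μ {x} := by
  set S : Set Γ := {x | 0 < μ {x}}
  have hS : S.Countable := Measure.countable_meas_pos_of_disjoint_iUnion
    (fun x => measurableSet_singleton x) fun x y h => Set.disjoint_singleton.2 h
  have h1 : ∫⁻ x, g x ∂μ = ∫⁻ x in S, g x ∂μ := by
    rw [← lintegral_indicator hS.measurableSet]
    congr 1
    funext x
    by_cases hx : x ∈ S
    · rw [Set.indicator_of_mem hx]
    · rw [Set.indicator_of_notMem hx]
      exact hg x (by simpa [S] using hx)
  rw [h1, lintegral_countable _ hS]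
  refine tsum_subtype_eq_of_support_subset (f := fun x => g x * μ {x}) fun x hx => ?_
  exact pos_iff_ne_zero.2 (right_ne_zero_of_mul hx)

lemma tsum_mul_measure_singleton_le {Γ : Type*} [MeasurableSpace Γ] [MeasurableSingletonClass Γ]
    (μ : Measure Γ) {g : Γ → ℝ≥0∞} {C : ℝ≥0∞} (hg : ∀ x, g x ≤ C) :
    ∑' x, g x * μ {x} ≤ C * μ Set.univ := by
  refine ENNReal.summable.tsum_le_of_sum_le fun s => ?_
  calc ∑ x ∈ s, g x * μ {x} ≤ ∑ x ∈ s, C * μ {x} :=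
        Finset.sum_le_sum fun x _ => mul_le_mul_left (hg x) _
    _ = C * μ s := by rw [← Finset.mul_sum, sum_measure_singleton]
    _ ≤ C * μ Set.univ := mul_le_mul_right (measure_mono (Set.subset_univ _)) _

/-- A bounded set function that is continuous along the cells around each point, summed against a
finite measure over the cells, tends to the corresponding sum over the atoms of the measure. -/
lemma tendsto_sum_cell [MeasurableSingletonClass Γ] (μ : Measure Γ) [IsFiniteMeasure μ]
    {G : Set Γ → ℝ≥0∞} {C : ℝ≥0∞} (hC : C ≠ ∞) (hb : ∀ A, G A ≤ C)
    (hlim : ∀ x, Filter.Tendsto (fun n => G (cell n (cellIndex n x))) Filter.atTop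
      (nhds (G {x})))
    (hG : ∀ x, μ {x} = 0 → G {x} = 0) :
    Filter.Tendsto (fun n => ∑ s, G (cell n s) * μ (cell n s)) Filter.atTop
      (nhds (∑' x, G {x} * μ {x})) := by
  rw [← lintegral_eq_tsum_singleton μ hG]
  have e : ∀ n, ∑ s, G (cell n s) * μ (cell n s) = ∫⁻ x, G (cell n (cellIndex n x)) ∂μ :=
    fun n => sum_mul_measure_cell μ n fun s => G (cell n s)
  simp only [e]
  refine tendsto_lintegral_of_dominated_convergence (fun _ => C) (fun n => ?_)
    (fun n => Filter.Eventually.of_forall fun x => hb _) ?_ (Filter.Eventually.of_forall hlim)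
  · exact (measurable_of_finite fun s => G (cell n s)).comp (measurable_cellIndex n)
  · rw [lintegral_const]
    exact ENNReal.mul_ne_top hC (measure_ne_top μ _)

end

/-! ### Berry–Esseen for sums of nonnegative random variables, in terms of raw moments -/

lemma integrable_pow_three {Ω : Type*} [MeasurableSpace Ω] {P : Measure Ω} {X : Ω → ℝ}
    (h0 : ∀ ω, 0 ≤ X ω) (h3 : MemLp X 3 P) :
    Integrable (fun ω => X ω ^ 3) P := by
  simpa only [abs_of_nonneg (h0 _)] using integrable_abs_pow_three h3

section

variable {Ω : Type*} [MeasurableSpace Ω] {P : Measure Ω} [IsProbabilityMeasure P]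

lemma integral_sub_integral_sq {X : Ω → ℝ} (h2 : MemLp X 2 P) :
    ∫ ω, (X ω - ∫ ω', X ω' ∂P) ^ 2 ∂P = ∫ ω, X ω ^ 2 ∂P - (∫ ω, X ω ∂P) ^ 2 := by
  rw [← variance_eq_integral h2.1.aemeasurable, variance_eq_sub h2]
  rfl

lemma sq_integral_le {X : Ω → ℝ} (h2 : MemLp X 2 P) :
    (∫ ω, X ω ∂P) ^ 2 ≤ ∫ ω, X ω ^ 2 ∂P := by
  have h := integral_sub_integral_sq h2
  have : 0 ≤ ∫ ω, (X ω - ∫ ω', X ω' ∂P) ^ 2 ∂P := integral_nonneg fun ω => sq_nonneg _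
  linarith

/-- Expand `E (X + m) (X - m)² ≥ 0`, where `m` is the mean of `X`. -/
lemma integral_sq_mul_integral_le {X : Ω → ℝ} (h0 : ∀ ω, 0 ≤ X ω) (h3 : MemLp X 3 P) :
    (∫ ω, X ω ^ 2 ∂P) * ∫ ω, X ω ∂P ≤ ∫ ω, X ω ^ 3 ∂P := by
  have h2 : MemLp X 2 P := h3.mono_exponent (by norm_num)
  have i1 : Integrable X P := h2.integrable one_le_two
  have i2 := h2.integrable_sq
  have i3 := integrable_pow_three h0 h3
  set m := ∫ ω, X ω ∂P with hm
  have hm0 : 0 ≤ m := integral_nonneg h0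
  have h : 0 ≤ ∫ ω, (X ω ^ 3 - (m * X ω ^ 2 + m ^ 2 * (X ω - m))) ∂P :=
    integral_nonneg fun ω => by
      have : X ω ^ 3 - (m * X ω ^ 2 + m ^ 2 * (X ω - m)) = (X ω + m) * (X ω - m) ^ 2 := by ring
      simp only [Pi.zero_apply, this]
      have := h0 ω
      positivity
  have i4 : Integrable (fun ω => m ^ 2 * (X ω - m)) P :=
    (i1.sub (integrable_const m)).const_mul _
  have i5 : Integrable (fun ω => m * X ω ^ 2 + m ^ 2 * (X ω - m)) P := (i2.const_mul m).add i4
  rw [integral_sub i3 i5, integral_add (i2.const_mul m) i4, integral_const_mul,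
    integral_const_mul, integral_sub i1 (integrable_const m), ← hm] at h
  simp only [integral_const, probReal_univ, smul_eq_mul, one_mul, sub_self, mul_zero,
    add_zero] at h
  linarith

lemma integral_abs_sub_pow_three_le {X : Ω → ℝ} (h0 : ∀ ω, 0 ≤ X ω) (h3 : MemLp X 3 P) :
    ∫ ω, |X ω - ∫ ω', X ω' ∂P| ^ 3 ∂P ≤
      ∫ ω, X ω ^ 3 ∂P + (∫ ω, X ω ^ 2 ∂P) * ∫ ω, X ω ∂P := by
  have h2 : MemLp X 2 P := h3.mono_exponent (by norm_num)
  have i3 := integrable_pow_three h0 h3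
  have hsq := sq_integral_le h2
  set m := ∫ ω, X ω ∂P
  have hm0 : 0 ≤ m := integral_nonneg h0
  have hp : ∀ ω, |X ω - m| ^ 3 ≤ X ω ^ 3 + m ^ 3 := fun ω => by
    have hx := h0 ω
    have hx3 := pow_nonneg hx 3
    have hm3 := pow_nonneg hm0 3
    rcases le_total m (X ω) with h | h
    · rw [abs_of_nonneg (sub_nonneg.2 h)]
      have := pow_le_pow_left₀ (sub_nonneg.2 h) (by linarith : X ω - m ≤ X ω) 3
      linarith
    · rw [abs_of_nonpos (sub_nonpos.2 h)]
      have := pow_le_pow_left₀ (by linarith : 0 ≤ -(X ω - m)) (by linarith : -(X ω - m) ≤ m) 3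
      linarith
  have hi : Integrable (fun ω => |X ω - m| ^ 3) P :=
    integrable_abs_pow_three (X := fun ω => X ω - m) (h3.sub (memLp_const m))
  refine (integral_mono hi (i3.add (integrable_const _)) hp).trans ?_
  simp only [Pi.add_apply]
  rw [integral_add i3 (integrable_const _)]
  simp only [integral_const, probReal_univ, smul_eq_mul, one_mul]
  nlinarith

lemma integral_abs_sub_mul_le {X : Ω → ℝ} (h0 : ∀ ω, 0 ≤ X ω) (h2 : MemLp X 2 P) :
    (∫ ω, |X ω - ∫ ω', X ω' ∂P| ∂P) * ∫ ω, (X ω - ∫ ω', X ω' ∂P) ^ 2 ∂P ≤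
      2 * ((∫ ω, X ω ^ 2 ∂P) * ∫ ω, X ω ∂P) := by
  have i1 : Integrable X P := h2.integrable one_le_two
  have hv := integral_sub_integral_sq h2
  set m := ∫ ω, X ω ∂P with hm
  have hm0 : 0 ≤ m := integral_nonneg h0
  have hv0 : 0 ≤ ∫ ω, (X ω - m) ^ 2 ∂P := integral_nonneg fun ω => sq_nonneg _
  have h1 : ∫ ω, |X ω - m| ∂P ≤ 2 * m := by
    have hp : ∀ ω, |X ω - m| ≤ X ω + m := fun ω => by
      have := h0 ω
      rw [abs_le]
      constructor <;> linarith
    refine (integral_mono (i1.sub (integrable_const m)).abs (i1.add (integrable_const m))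
      hp).trans (le_of_eq ?_)
    simp only [Pi.add_apply]
    rw [integral_add i1 (integrable_const _), ← hm]
    simp only [integral_const, probReal_univ, smul_eq_mul, one_mul]
    ring
  have h3 : ∫ ω, (X ω - m) ^ 2 ∂P ≤ ∫ ω, X ω ^ 2 ∂P := by nlinarith
  calc _ ≤ 2 * m * ∫ ω, X ω ^ 2 ∂P := mul_le_mul h1 h3 hv0 (by linarith)
    _ = _ := by ring

/-- The Berry–Esseen bound for a sum of independent nonnegative random variables. -/
theorem abs_measureReal_standardized_sum_sub_gaussian_le {ι : Type*} [Fintype ι] {X : ι → Ω → ℝ}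
    (hm : ∀ i, Measurable (X i)) (hX0 : ∀ i ω, 0 ≤ X i ω) (hind : iIndepFun X P)
    (h3 : ∀ i, MemLp (X i) 3 P) {B : ℝ} (hB : 0 < B)
    (hvar : variance (fun ω => ∑ i, X i ω) P = B ^ 2) (z : ℝ) :
    |P.real ((fun ω => (∑ i, X i ω - ∫ ω', ∑ i, X i ω' ∂P) / B) ⁻¹' Set.Iic z)
        - (gaussianReal 0 1).real (Set.Iic z)| ≤
      5.5 / B ^ 3 * ∑ i, ∫ ω, X i ω ^ 3 ∂P
        + 25.5 / B ^ 3 * ∑ i, (∫ ω, X i ω ^ 2 ∂P) * ∫ ω, X i ω ∂P := by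
  classical
  have h2 : ∀ i, MemLp (X i) 2 P := fun i => (h3 i).mono_exponent (by norm_num)
  have h1 : ∀ i, Integrable (X i) P := fun i => (h2 i).integrable one_le_two
  set m : ι → ℝ := fun i => ∫ ω, X i ω ∂P
  set ξ : ι → Ω → ℝ := fun i ω => (X i ω - m i) / B
  have hmean : ∫ ω', ∑ i, X i ω' ∂P = ∑ i, m i := integral_finsetSum _ fun i _ => h1 i
  have hW : (fun ω => (∑ i, X i ω - ∫ ω', ∑ i, X i ω' ∂P) / B) = fun ω => ∑ i, ξ i ω := by
    funext ω
    rw [hmean, ← Finset.sum_sub_distrib, Finset.sum_div]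
  have hsq : ∀ i, ∫ ω, ξ i ω ^ 2 ∂P = (∫ ω, (X i ω - m i) ^ 2 ∂P) / B ^ 2 := fun i => by
    simp only [ξ, div_pow]; rw [integral_div]
  have habs : ∀ i, ∫ ω, |ξ i ω| ∂P = (∫ ω, |X i ω - m i| ∂P) / B := fun i => by
    simp only [ξ, abs_div, abs_of_pos hB]; rw [integral_div]
  have hcube : ∀ i, ∫ ω, |ξ i ω| ^ 3 ∂P = (∫ ω, |X i ω - m i| ^ 3 ∂P) / B ^ 3 := fun i => by
    simp only [ξ, abs_div, abs_of_pos hB, div_pow]; rw [integral_div]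
  have hξvar : ∑ i, ∫ ω, ξ i ω ^ 2 ∂P = 1 := by
    have hs := IndepFun.variance_sum (s := Finset.univ) (fun i _ => h2 i)
      (fun i _ j _ hij => hind.indepFun hij)
    have e : (∑ i, X i) = fun ω => ∑ i, X i ω := by funext ω; simp
    rw [e, hvar] at hs
    simp only [hsq]
    rw [← Finset.sum_div, div_eq_one_iff_eq (by positivity), hs]
    exact Finset.sum_congr rfl fun i _ => (variance_eq_integral (hm i).aemeasurable).symm
  have hBE := abs_measureReal_sum_Iic_sub_gaussian_le (ξ := ξ) (P := P)
    (fun i => ((hm i).sub_const _).div_const _)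
    (hind.comp (fun i x => (x - m i) / B) fun i => (measurable_id.sub_const _).div_const _)
    (fun i => by
      simp only [ξ, div_eq_mul_inv]
      exact ((h3 i).sub (memLp_const (m i))).mul_const _)
    (fun i => by
      simp only [ξ]
      rw [integral_div, integral_sub (h1 i) (integrable_const _)]
      simp [m]) hξvar z
  rw [hW]
  refine hBE.trans ?_
  have hB3 : 0 < B ^ 3 := by positivity
  have k1 : ∑ i, ∫ ω, |ξ i ω| ^ 3 ∂P ≤
      (∑ i, ∫ ω, X i ω ^ 3 ∂P + ∑ i, (∫ ω, X i ω ^ 2 ∂P) * m i) / B ^ 3 := by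
    rw [← Finset.sum_add_distrib, Finset.sum_div]
    refine Finset.sum_le_sum fun i _ => ?_
    rw [hcube]
    exact div_le_div_of_nonneg_right (integral_abs_sub_pow_three_le (hX0 i) (h3 i)) hB3.le
  have k2 : ∑ i, (∫ ω, |ξ i ω| ∂P) * ∫ ω, ξ i ω ^ 2 ∂P ≤
      2 * (∑ i, (∫ ω, X i ω ^ 2 ∂P) * m i) / B ^ 3 := by
    rw [Finset.mul_sum, Finset.sum_div]
    refine Finset.sum_le_sum fun i _ => ?_
    rw [hsq, habs, div_mul_div_comm, show B * B ^ 2 = B ^ 3 by ring]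
    exact div_le_div_of_nonneg_right (integral_abs_sub_mul_le (hX0 i) (h2 i)) hB3.le
  calc _ ≤ 11 / 2 * ((∑ i, ∫ ω, X i ω ^ 3 ∂P + ∑ i, (∫ ω, X i ω ^ 2 ∂P) * m i) / B ^ 3)
        + 10 * (2 * (∑ i, (∫ ω, X i ω ^ 2 ∂P) * m i) / B ^ 3) := by gcongr
    _ = _ := by ring

end

/-! ### Completely random measures with finite fourth moment -/

lemma IsCompletelyRandom.iIndepFun {Ω Γ ι : Type*} [MeasurableSpace Ω] [MeasurableSpace Γ]
    [Fintype ι] {P : Measure Ω} {Ξ : Ω → Measure Γ} (h : IsCompletelyRandom P Ξ) {A : ι → Set Γ}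
    (hA : ∀ i, MeasurableSet (A i)) (hd : Pairwise (Function.onFun Disjoint A)) :
    iIndepFun (fun i ω => Ξ ω (A i)) P := by
  have e := Fintype.equivFin ι
  have h1 := h (Fintype.card ι) (fun k => A (e.symm k)) (fun k => hA _)
    fun i j hij => hd (e.symm.injective.ne hij)
  have h2 := h1.precomp e.injective
  simpa using h2

lemma ae_measure_univ_lt_top {Ω Γ : Type*} [MeasurableSpace Ω] [MeasurableSpace Γ] {P : Measure Ω}
    {Ξ : Ω → Measure Γ} (hΞ : Measurable Ξ)
    (h4 : ∫⁻ ω, Ξ ω Set.univ ^ 4 ∂P < ∞) : ∀ᵐ ω ∂P, Ξ ω Set.univ < ∞ := by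
  have hm : Measurable fun ω => Ξ ω Set.univ := Measure.measurable_coe MeasurableSet.univ |>.comp hΞ
  filter_upwards [ae_lt_top (hm.pow_const 4) h4.ne] with ω hω
  exact lt_top_iff_ne_top.2 fun h => by simp [h] at hω

lemma lintegral_measure_pow_le {Ω Γ : Type*} [MeasurableSpace Ω] [MeasurableSpace Γ] {P : Measure Ω}
    {Ξ : Ω → Measure Γ} (k : ℕ) (A : Set Γ) :
    ∫⁻ ω, Ξ ω A ^ k ∂P ≤ ∫⁻ ω, Ξ ω Set.univ ^ k ∂P :=
  lintegral_mono fun _ => pow_le_pow_left₀ zero_le (measure_mono (Set.subset_univ _)) k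

lemma integral_measureReal_pow {Ω Γ : Type*} [MeasurableSpace Ω] [MeasurableSpace Γ] {P : Measure Ω}
    {Ξ : Ω → Measure Γ} (hΞ : Measurable Ξ)
    (h4 : ∫⁻ ω, Ξ ω Set.univ ^ 4 ∂P < ∞)
    {A : Set Γ} (hA : MeasurableSet A) (k : ℕ) :
    ∫ ω, (Ξ ω).real A ^ k ∂P = (∫⁻ ω, Ξ ω A ^ k ∂P).toReal := by
  have hm : Measurable fun ω => Ξ ω A := (Measure.measurable_coe hA).comp hΞ
  rw [← integral_toReal (hm.pow_const k).aemeasurable]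
  · simp [Measure.real]
  · filter_upwards [ae_measure_univ_lt_top hΞ h4] with ω hω
    exact ENNReal.pow_lt_top ((measure_mono (Set.subset_univ _)).trans_lt hω)

section

variable {Ω Γ : Type*} [MeasurableSpace Ω] [MeasurableSpace Γ] {P : Measure Ω}
  [IsProbabilityMeasure P] {Ξ : Ω → Measure Γ}

lemma lintegral_measure_univ_pow_lt_top (h4 : ∫⁻ ω, Ξ ω Set.univ ^ 4 ∂P < ∞) {k : ℕ}
    (hk : k ≤ 4) : ∫⁻ ω, Ξ ω Set.univ ^ k ∂P < ∞ := by
  calc ∫⁻ ω, Ξ ω Set.univ ^ k ∂P ≤ ∫⁻ ω, (1 + Ξ ω Set.univ ^ 4) ∂P := by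
        refine lintegral_mono fun ω => ?_
        rcases le_total (Ξ ω Set.univ) 1 with h | h
        · exact (pow_le_one₀ zero_le h).trans le_self_add
        · exact (pow_le_pow_right₀ h hk).trans le_add_self
    _ < ∞ := by
        rw [lintegral_add_left measurable_const]
        simpa using h4

lemma measurable_measureReal (hΞ : Measurable Ξ) {A : Set Γ} (hA : MeasurableSet A) :
    Measurable fun ω => (Ξ ω).real A :=
  ((Measure.measurable_coe hA).comp hΞ).ennreal_toReal

lemma memLp_measureReal (hΞ : Measurable Ξ) (h4 : ∫⁻ ω, Ξ ω Set.univ ^ 4 ∂P < ∞)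
    {A : Set Γ} (hA : MeasurableSet A) : MemLp (fun ω => (Ξ ω).real A) 3 P := by
  refine ⟨(measurable_measureReal hΞ hA).aestronglyMeasurable, ?_⟩
  rw [eLpNorm_lt_top_iff_lintegral_rpow_enorm_lt_top (by norm_num) (by norm_num)]
  refine lt_of_le_of_lt (lintegral_mono fun ω => ?_)
    (lintegral_measure_univ_pow_lt_top h4 (k := 3) (by norm_num))
  have h : ‖(Ξ ω).real A‖ₑ ≤ Ξ ω Set.univ := by
    rw [Real.enorm_of_nonneg measureReal_nonneg]
    exact ENNReal.ofReal_toReal_le.trans (measure_mono (Set.subset_univ _))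
  have e : ((3 : ℝ≥0∞).toReal) = ((3 : ℕ) : ℝ) := by norm_num
  rw [e, ENNReal.rpow_natCast]
  exact pow_le_pow_left₀ zero_le h 3

lemma isFiniteMeasure_meanMeasure (hΞ : Measurable Ξ) (h4 : ∫⁻ ω, Ξ ω Set.univ ^ 4 ∂P < ∞) :
    IsFiniteMeasure (meanMeasure P Ξ) := by
  refine ⟨?_⟩
  rw [meanMeasure_apply P hΞ MeasurableSet.univ]
  simpa using lintegral_measure_univ_pow_lt_top h4 (k := 1) (by norm_num)

lemma tsum_lintegral_pow_mul_meanMeasure_lt_top [MeasurableSingletonClass Γ]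
    (hΞ : Measurable Ξ) (h4 : ∫⁻ ω, Ξ ω Set.univ ^ 4 ∂P < ∞) {k : ℕ} (hk : k ≤ 4) :
    ∑' α, (∫⁻ ω, Ξ ω {α} ^ k ∂P) * meanMeasure P Ξ {α} < ∞ := by
  have := isFiniteMeasure_meanMeasure hΞ h4
  exact (tsum_mul_measure_singleton_le _ fun α => lintegral_measure_pow_le k {α}).trans_lt
    (ENNReal.mul_lt_top (lintegral_measure_univ_pow_lt_top h4 hk) (measure_lt_top _ _))

lemma tsum_measure_singleton_pow_three_le {Γ : Type*} [MeasurableSpace Γ]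
    [MeasurableSingletonClass Γ] (ν : Measure Γ) : ∑' α, ν {α} ^ 3 ≤ ν Set.univ ^ 3 := by
  have h := tsum_mul_measure_singleton_le ν (g := fun α => ν {α} ^ 2) (C := ν Set.univ ^ 2)
    fun α => pow_le_pow_left₀ zero_le (measure_mono (Set.subset_univ _)) 2
  simpa only [← pow_succ] using h

lemma meanSumCube_lt_top [MeasurableSingletonClass Γ]
    (h4 : ∫⁻ ω, Ξ ω Set.univ ^ 4 ∂P < ∞) : meanSumCube P Ξ < ∞ :=
  (lintegral_mono fun _ => tsum_measure_singleton_pow_three_le _).trans_lt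
    (lintegral_measure_univ_pow_lt_top h4 (by norm_num))

variable [MeasurableSpace.CountablyGenerated Γ] [MeasurableSingletonClass Γ]

lemma tendsto_sum_lintegral_cell_pow_three (hΞ : Measurable Ξ)
    (h4 : ∫⁻ ω, Ξ ω Set.univ ^ 4 ∂P < ∞) :
    Filter.Tendsto (fun n => ∑ s, ∫⁻ ω, Ξ ω (cell n s) ^ 3 ∂P) Filter.atTop
      (nhds (meanSumCube P Ξ)) := by
  have hm : ∀ n s, Measurable fun ω => Ξ ω (cell n s) ^ 3 := fun n s =>
    ((Measure.measurable_coe (measurableSet_cell n s)).comp hΞ).pow_const 3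
  have e : ∀ n, ∑ s, ∫⁻ ω, Ξ ω (cell n s) ^ 3 ∂P = ∫⁻ ω, ∑ s, Ξ ω (cell n s) ^ 3 ∂P :=
    fun n => (lintegral_finsetSum _ fun s _ => hm n s).symm
  simp only [e]
  refine tendsto_lintegral_of_dominated_convergence (fun ω => Ξ ω Set.univ ^ 3)
    (fun n => Finset.measurable_sum _ fun s _ => hm n s)
    (fun n => Filter.Eventually.of_forall fun ω => ?_)
    (lintegral_measure_univ_pow_lt_top h4 (by norm_num)).ne ?_
  · calc ∑ s, Ξ ω (cell n s) ^ 3 ≤ ∑ s, Ξ ω Set.univ ^ 2 * Ξ ω (cell n s) := by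
          refine Finset.sum_le_sum fun s _ => ?_
          rw [pow_succ]
          gcongr
          exact Set.subset_univ _
      _ = Ξ ω Set.univ ^ 3 := by rw [← Finset.mul_sum, sum_measure_cell, ← pow_succ]
  · filter_upwards [ae_measure_univ_lt_top hΞ h4] with ω hω
    have : IsFiniteMeasure (Ξ ω) := ⟨hω⟩
    have h := tendsto_sum_cell (Ξ ω) (G := fun A => Ξ ω A ^ 2) (C := Ξ ω Set.univ ^ 2)
      (ENNReal.pow_ne_top hω.ne)
      (fun A => pow_le_pow_left₀ zero_le (measure_mono (Set.subset_univ _)) 2)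
      (fun x => ENNReal.Tendsto.pow (tendsto_measure_cell hω.ne x))
      (fun x hx => by simp [hx])
    simpa only [← pow_succ] using h

lemma tendsto_sum_lintegral_cell_sq_mul (hΞ : Measurable Ξ)
    (h4 : ∫⁻ ω, Ξ ω Set.univ ^ 4 ∂P < ∞) :
    Filter.Tendsto
      (fun n => ∑ s, (∫⁻ ω, Ξ ω (cell n s) ^ 2 ∂P) * ∫⁻ ω, Ξ ω (cell n s) ∂P) Filter.atTop
      (nhds (sumSqMean P Ξ)) := by
  have := isFiniteMeasure_meanMeasure hΞ h4
  have h2 := lintegral_measure_univ_pow_lt_top h4 (k := 2) (by norm_num)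
  have hm : ∀ A, MeasurableSet A → Measurable fun ω => Ξ ω A := fun A hA =>
    (Measure.measurable_coe hA).comp hΞ
  have h := tendsto_sum_cell (meanMeasure P Ξ) (G := fun A => ∫⁻ ω, Ξ ω A ^ 2 ∂P) h2.ne
    (lintegral_measure_pow_le 2) (fun x => ?_) fun x hx => ?_
  · unfold sumSqMean
    simpa only [meanMeasure_apply P hΞ (measurableSet_cell _ _)] using h
  · refine tendsto_lintegral_of_dominated_convergence (fun ω => Ξ ω Set.univ ^ 2)
      (fun n => (hm _ (measurableSet_cell n _)).pow_const 2)
      (fun n => Filter.Eventually.of_forall fun ω =>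
        pow_le_pow_left₀ zero_le (measure_mono (Set.subset_univ _)) 2) h2.ne ?_
    filter_upwards [ae_measure_univ_lt_top hΞ h4] with ω hω
    exact ENNReal.Tendsto.pow (tendsto_measure_cell hω.ne x)
  · rw [meanMeasure_apply P hΞ (measurableSet_singleton x),
      lintegral_eq_zero_iff (hm _ (measurableSet_singleton x))] at hx
    refine (lintegral_congr_ae ?_).trans lintegral_zero
    filter_upwards [hx] with ω hω
    simp [hω]

/-- The third moments of the masses of the cells, in real form. -/
lemma tendsto_sum_integral_cell_pow_three (hΞ : Measurable Ξ)
    (h4 : ∫⁻ ω, Ξ ω Set.univ ^ 4 ∂P < ∞) :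
    Filter.Tendsto (fun n => ∑ s, ∫ ω, (Ξ ω).real (cell n s) ^ 3 ∂P) Filter.atTop
      (nhds (meanSumCube P Ξ).toReal) := by
  have h := (ENNReal.tendsto_toReal (meanSumCube_lt_top h4).ne).comp
    (tendsto_sum_lintegral_cell_pow_three hΞ h4)
  refine h.congr fun n => ?_
  simp only [Function.comp_apply]
  rw [ENNReal.toReal_sum fun s _ => ((lintegral_measure_pow_le 3 _).trans_lt
    (lintegral_measure_univ_pow_lt_top h4 (by norm_num))).ne]
  exact Finset.sum_congr rfl fun s _ =>
    (integral_measureReal_pow hΞ h4 (measurableSet_cell n s) 3).symm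

lemma tendsto_sum_integral_cell_sq_mul (hΞ : Measurable Ξ)
    (h4 : ∫⁻ ω, Ξ ω Set.univ ^ 4 ∂P < ∞) :
    Filter.Tendsto (fun n => ∑ s, (∫ ω, (Ξ ω).real (cell n s) ^ 2 ∂P) *
      ∫ ω, (Ξ ω).real (cell n s) ∂P) Filter.atTop (nhds (sumSqMean P Ξ).toReal) := by
  have hfin : sumSqMean P Ξ < ∞ :=
    tsum_lintegral_pow_mul_meanMeasure_lt_top hΞ h4 (by norm_num)
  have h := (ENNReal.tendsto_toReal hfin.ne).comp (tendsto_sum_lintegral_cell_sq_mul hΞ h4)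
  have hk : ∀ k ≤ 4, ∀ A, ∫⁻ ω, Ξ ω A ^ k ∂P ≠ ∞ := fun k hk A =>
    ((lintegral_measure_pow_le k A).trans_lt (lintegral_measure_univ_pow_lt_top h4 hk)).ne
  have h1 : ∀ A, ∫⁻ ω, Ξ ω A ∂P ≠ ∞ := fun A => by simpa using hk 1 (by norm_num) A
  refine h.congr fun n => ?_
  simp only [Function.comp_apply]
  rw [ENNReal.toReal_sum fun s _ => ENNReal.mul_ne_top (hk 2 (by norm_num) _) (h1 _)]
  refine Finset.sum_congr rfl fun s _ => ?_
  have e := integral_measureReal_pow hΞ h4 (measurableSet_cell n s) 1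
  simp only [pow_one] at e
  rw [ENNReal.toReal_mul, ← integral_measureReal_pow hΞ h4 (measurableSet_cell n s) 2, e]

lemma toReal_sumSqMean_le (hΞ : Measurable Ξ) (h4 : ∫⁻ ω, Ξ ω Set.univ ^ 4 ∂P < ∞) :
    (sumSqMean P Ξ).toReal ≤ (meanSumCube P Ξ).toReal :=
  le_of_tendsto_of_tendsto' (tendsto_sum_integral_cell_sq_mul hΞ h4)
    (tendsto_sum_integral_cell_pow_three hΞ h4) fun n => Finset.sum_le_sum fun s _ =>
      integral_sq_mul_integral_le (fun _ => measureReal_nonneg)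
        (memLp_measureReal hΞ h4 (measurableSet_cell n s))

/-- The normal approximation of the total mass of a completely random measure: apply the
Berry–Esseen bound to the masses of the cells of finer and finer partitions. -/
theorem normalDist_le (hΞ : Measurable Ξ) (hcr : IsCompletelyRandom P Ξ)
    (h4 : ∫⁻ ω, Ξ ω Set.univ ^ 4 ∂P < ∞) (hvar : 0 < variance (totalMass Ξ) P) :
    normalDist P Ξ ≤ 5.5 / massStd P Ξ ^ 3 * (meanSumCube P Ξ).toReal
      + 25.5 / massStd P Ξ ^ 3 * (sumSqMean P Ξ).toReal := by
  set B := massStd P Ξ with hBdef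
  have hB : 0 < B := Real.sqrt_pos.2 hvar
  have hB2 : B ^ 2 = variance (totalMass Ξ) P := Real.sq_sqrt hvar.le
  have hWm : Measurable (standardizedMass P Ξ) :=
    ((measurable_measureReal hΞ MeasurableSet.univ).sub_const _).div_const _
  refine ciSup_le fun z => ?_
  rw [map_measureReal_apply hWm measurableSet_Iic]
  refine ge_of_tendsto' (((tendsto_sum_integral_cell_pow_three hΞ h4).const_mul (5.5 / B ^ 3)).add
    ((tendsto_sum_integral_cell_sq_mul hΞ h4).const_mul (25.5 / B ^ 3))) fun n => ?_
  have hsum : totalMass Ξ =ᵐ[P] fun ω => ∑ s, (Ξ ω).real (cell n s) := by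
    filter_upwards [ae_measure_univ_lt_top hΞ h4] with ω hω
    have : IsFiniteMeasure (Ξ ω) := ⟨hω⟩
    rw [totalMass, Measure.real, ← sum_measure_cell (Ξ ω) n,
      ENNReal.toReal_sum fun s _ => measure_ne_top _ _]
    rfl
  have hmean := integral_congr_ae hsum
  -- The total mass may be infinite on a null set, where `totalMass` is not the sum over the cells.
  have hset : standardizedMass P Ξ ⁻¹' Set.Iic z =ᵐ[P]
      (fun ω => (∑ s, (Ξ ω).real (cell n s)
        - ∫ ω', ∑ s, (Ξ ω').real (cell n s) ∂P) / B) ⁻¹' Set.Iic z := by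
    filter_upwards [hsum] with ω hω
    have e : standardizedMass P Ξ ω = (∑ s, (Ξ ω).real (cell n s)
        - ∫ ω', ∑ s, (Ξ ω').real (cell n s) ∂P) / B := by
      rw [standardizedMass, hω, hmean]
    change (standardizedMass P Ξ ω ∈ Set.Iic z) = (_ ∈ Set.Iic z)
    rw [e]
  rw [measureReal_congr hset]
  exact abs_measureReal_standardized_sum_sub_gaussian_le
    (fun s => measurable_measureReal hΞ (measurableSet_cell n s))
    (fun _ _ => measureReal_nonneg)
    ((hcr.iIndepFun (measurableSet_cell n) (pairwise_disjoint_cell n)).comp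
      (fun _ => ENNReal.toReal) fun _ => ENNReal.measurable_toReal)
    (fun s => memLp_measureReal hΞ h4 (measurableSet_cell n s)) hB
    (by rw [hB2]; exact (variance_congr hsum).symm) z

end

/-! ### Poisson processes -/

lemma succ_mul_poissonMeasure_singleton (r : NNReal) (n : ℕ) :
    ((n + 1 : ℕ) : ℝ≥0∞) * poissonMeasure r {n + 1} = r * poissonMeasure r {n} := by
  rw [poissonMeasure_singleton, poissonMeasure_singleton, ← ENNReal.ofReal_natCast,
    ← ENNReal.ofReal_mul (by positivity), ← ENNReal.ofReal_coe_nnreal,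
    ← ENNReal.ofReal_mul (by positivity)]
  congr 1
  rw [Nat.factorial_succ]
  push_cast
  field_simp
  exact pow_succ' _ _

/-- The Stein–Chen identity `E N g(N) = r E g(N + 1)` for a Poisson variable `N` with mean `r`. -/
lemma lintegral_mul_poissonMeasure (r : NNReal) (g : ℕ → ℝ≥0∞) :
    ∫⁻ n, n * g n ∂poissonMeasure r = r * ∫⁻ n, g (n + 1) ∂poissonMeasure r := by
  rw [lintegral_countable', lintegral_countable', ← ENNReal.tsum_mul_left,
    tsum_eq_zero_add' ENNReal.summable]
  simp only [Nat.cast_zero, zero_mul, zero_add]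
  refine tsum_congr fun n => ?_
  calc _ = ((n + 1 : ℕ) : ℝ≥0∞) * poissonMeasure r {n + 1} * g (n + 1) := by ring
    _ = _ := by rw [succ_mul_poissonMeasure_singleton]; ring

lemma lintegral_poissonMeasure (r : NNReal) : ∫⁻ n, (n : ℝ≥0∞) ∂poissonMeasure r = r := by
  simpa using lintegral_mul_poissonMeasure r fun _ => 1

lemma lintegral_sq_poissonMeasure (r : NNReal) :
    ∫⁻ n, (n : ℝ≥0∞) ^ 2 ∂poissonMeasure r = r ^ 2 + r := by
  have h := lintegral_mul_poissonMeasure r fun n => n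
  simp only [Nat.cast_add, Nat.cast_one, ← pow_two] at h
  rw [h, lintegral_add_left .of_discrete, lintegral_poissonMeasure]
  simp only [lintegral_const, measure_univ, mul_one]
  ring

lemma lintegral_pow_three_poissonMeasure (r : NNReal) :
    ∫⁻ n, (n : ℝ≥0∞) ^ 3 ∂poissonMeasure r = r ^ 3 + 3 * r ^ 2 + r := by
  have h := lintegral_mul_poissonMeasure r fun n => n ^ 2
  have e : ∀ n : ℕ, (((n + 1 : ℕ) : ℝ≥0∞)) ^ 2 = n ^ 2 + (2 * n + 1) := fun n => by
    push_cast; ring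
  simp only [e, ← pow_succ'] at h
  rw [h, lintegral_add_left .of_discrete, lintegral_add_left .of_discrete,
    lintegral_const_mul _ .of_discrete, lintegral_poissonMeasure, lintegral_sq_poissonMeasure]
  simp only [lintegral_const, measure_univ, mul_one]
  ring

lemma lintegral_pow_four_poissonMeasure_lt_top (r : NNReal) :
    ∫⁻ n, (n : ℝ≥0∞) ^ 4 ∂poissonMeasure r < ∞ := by
  have h := lintegral_mul_poissonMeasure r fun n => n ^ 3
  have e : ∀ n : ℕ, (((n + 1 : ℕ) : ℝ≥0∞)) ^ 3 = n ^ 3 + (3 * n ^ 2 + (3 * n + 1)) := fun n => by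
    push_cast; ring
  simp only [e, ← pow_succ'] at h
  rw [h, lintegral_add_left .of_discrete, lintegral_add_left .of_discrete,
    lintegral_add_left .of_discrete, lintegral_const_mul _ .of_discrete,
    lintegral_const_mul _ .of_discrete, lintegral_poissonMeasure, lintegral_sq_poissonMeasure,
    lintegral_pow_three_poissonMeasure]
  simp only [lintegral_const, measure_univ, mul_one]
  norm_cast
  exact ENNReal.coe_lt_top

namespace IsPoissonProcess

variable {Ω Γ : Type*} [MeasurableSpace Ω] [MeasurableSpace Γ] {P : Measure Ω}
  {Ξ : Ω → Measure Γ} {Λ : Measure Γ}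

lemma lintegral_pow (h : IsPoissonProcess P Ξ Λ) (hΞ : Measurable Ξ) {A : Set Γ}
    (hA : MeasurableSet A) (hfin : Λ A < ∞) (k : ℕ) :
    ∫⁻ ω, Ξ ω A ^ k ∂P = ∫⁻ n, (n : ℝ≥0∞) ^ k ∂poissonMeasure (Λ A).toNNReal := by
  have hm : Measurable fun ω => Ξ ω A := (Measure.measurable_coe hA).comp hΞ
  have hk : Measurable fun x : ℝ≥0∞ => x ^ k := measurable_id.pow_const k
  rw [← lintegral_map (f := fun x : ℝ≥0∞ => x ^ k) hk hm, h.law A hA hfin,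
    lintegral_map hk .of_discrete]

lemma lintegral_eq (h : IsPoissonProcess P Ξ Λ) (hΞ : Measurable Ξ) {A : Set Γ}
    (hA : MeasurableSet A) (hfin : Λ A < ∞) : ∫⁻ ω, Ξ ω A ∂P = Λ A := by
  have := h.lintegral_pow hΞ hA hfin 1
  simp only [pow_one] at this
  rw [this, lintegral_poissonMeasure, ENNReal.coe_toNNReal hfin.ne]

lemma lintegral_sq (h : IsPoissonProcess P Ξ Λ) (hΞ : Measurable Ξ) {A : Set Γ}
    (hA : MeasurableSet A) (hfin : Λ A < ∞) : ∫⁻ ω, Ξ ω A ^ 2 ∂P = Λ A ^ 2 + Λ A := by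
  rw [h.lintegral_pow hΞ hA hfin, lintegral_sq_poissonMeasure, ENNReal.coe_toNNReal hfin.ne]

lemma lintegral_pow_three (h : IsPoissonProcess P Ξ Λ) (hΞ : Measurable Ξ) {A : Set Γ}
    (hA : MeasurableSet A) (hfin : Λ A < ∞) :
    ∫⁻ ω, Ξ ω A ^ 3 ∂P = Λ A ^ 3 + 3 * Λ A ^ 2 + Λ A := by
  rw [h.lintegral_pow hΞ hA hfin, lintegral_pow_three_poissonMeasure,
    ENNReal.coe_toNNReal hfin.ne]

/-- The intensity measure of a simple Poisson process has no atoms: a Poisson variable `N` with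
`N ≤ 1` satisfies `E N² ≤ E N`. -/
lemma measure_singleton_eq_zero [MeasurableSingletonClass Γ] [IsFiniteMeasure Λ]
    (h : IsPoissonProcess P Ξ Λ) (hΞ : Measurable Ξ) (hs : IsSimple P Ξ) (α : Γ) :
    Λ {α} = 0 := by
  have hfin : Λ {α} < ∞ := measure_lt_top _ _
  have hle : ∫⁻ ω, Ξ ω {α} ^ 2 ∂P ≤ ∫⁻ ω, Ξ ω {α} ∂P := by
    refine lintegral_mono_ae ?_
    filter_upwards [hs] with ω hω
    exact pow_le_of_le_one zero_le (hω α) two_ne_zero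
  rw [h.lintegral_sq hΞ (measurableSet_singleton α) hfin,
    h.lintegral_eq hΞ (measurableSet_singleton α) hfin] at hle
  have : Λ {α} ^ 2 ≤ 0 := by
    refine (ENNReal.add_le_add_iff_right hfin.ne).1 ?_
    simpa using hle
  simpa using this

variable [IsFiniteMeasure Λ]

lemma lintegral_pow_four_lt_top (h : IsPoissonProcess P Ξ Λ) (hΞ : Measurable Ξ) :
    ∫⁻ ω, Ξ ω Set.univ ^ 4 ∂P < ∞ := by
  rw [h.lintegral_pow hΞ MeasurableSet.univ (measure_lt_top _ _)]
  exact lintegral_pow_four_poissonMeasure_lt_top _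

lemma variance_totalMass [IsProbabilityMeasure P] (h : IsPoissonProcess P Ξ Λ) (hΞ : Measurable Ξ) :
    variance (totalMass Ξ) P = Λ.real Set.univ := by
  have h4 := h.lintegral_pow_four_lt_top hΞ
  have hfin : Λ Set.univ < ∞ := measure_lt_top _ _
  have h2 : MemLp (totalMass Ξ) 2 P :=
    (memLp_measureReal hΞ h4 MeasurableSet.univ).mono_exponent (by norm_num)
  have e1 : ∫ ω, totalMass Ξ ω ∂P = Λ.real Set.univ := by
    have := integral_measureReal_pow hΞ h4 MeasurableSet.univ 1
    simp only [pow_one] at this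
    rw [h.lintegral_eq hΞ MeasurableSet.univ hfin] at this
    exact this
  have e2 : ∫ ω, (totalMass Ξ ^ 2) ω ∂P = Λ.real Set.univ ^ 2 + Λ.real Set.univ := by
    have := integral_measureReal_pow hΞ h4 MeasurableSet.univ 2
    rw [h.lintegral_sq hΞ MeasurableSet.univ hfin,
      ENNReal.toReal_add (ENNReal.pow_ne_top hfin.ne) hfin.ne, ENNReal.toReal_pow] at this
    exact this
  rw [variance_eq_sub h2, e1, e2]
  ring

variable [MeasurableSingletonClass Γ]

lemma sumCubeMean_eq_zero (h : IsPoissonProcess P Ξ Λ) (hΞ : Measurable Ξ) (hs : IsSimple P Ξ) :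
    sumCubeMean P Ξ = 0 := by
  refine ENNReal.tsum_eq_zero.2 fun α => ?_
  rw [meanMeasure_apply P hΞ (measurableSet_singleton α),
    h.lintegral_eq hΞ (measurableSet_singleton α) (measure_lt_top _ _),
    h.measure_singleton_eq_zero hΞ hs, mul_zero]

/-- The third moments `Λ(A)³ + 3 Λ(A)² + Λ(A)` of the masses of the cells add up to `Λ(Γ)` in the
limit, since the intensity measure has no atoms. -/
lemma meanSumCube_eq [IsProbabilityMeasure P] [MeasurableSpace.CountablyGenerated Γ]
    (h : IsPoissonProcess P Ξ Λ) (hΞ : Measurable Ξ) (hs : IsSimple P Ξ) :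
    meanSumCube P Ξ = Λ Set.univ := by
  have h4 := h.lintegral_pow_four_lt_top hΞ
  have hfin : ∀ A, Λ A < ∞ := fun A => measure_lt_top Λ A
  have hz := h.measure_singleton_eq_zero hΞ hs
  have hlim := tendsto_sum_cell Λ (G := fun A => Λ A ^ 2 + 3 * Λ A)
    (C := Λ Set.univ ^ 2 + 3 * Λ Set.univ)
    (ENNReal.add_ne_top.2 ⟨ENNReal.pow_ne_top (hfin _).ne,
      ENNReal.mul_ne_top (by norm_num) (hfin _).ne⟩)
    (fun A => by gcongr <;> exact Set.subset_univ _)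
    (fun x => (ENNReal.Tendsto.pow (tendsto_measure_cell (hfin _).ne x)).add
      (ENNReal.Tendsto.const_mul (tendsto_measure_cell (hfin _).ne x) (Or.inr (by norm_num))))
    (fun x hx => by simp [hx])
  simp only [hz, mul_zero, tsum_zero] at hlim
  refine tendsto_nhds_unique (tendsto_sum_lintegral_cell_pow_three hΞ h4) ?_
  have e : ∀ n, ∑ s, ∫⁻ ω, Ξ ω (cell n s) ^ 3 ∂P =
      ∑ s, (Λ (cell n s) ^ 2 + 3 * Λ (cell n s)) * Λ (cell n s) + Λ Set.univ := fun n => by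
    rw [← sum_measure_cell Λ n, ← Finset.sum_add_distrib]
    refine Finset.sum_congr rfl fun s _ => ?_
    rw [h.lintegral_pow_three hΞ (measurableSet_cell n s) (hfin _)]
    ring
  simp only [e]
  simpa using hlim.add_const (Λ Set.univ)

end IsPoissonProcess

/-- The three-term bound is at most the two-term bound, as `5.5 + 25.5 = 31`. -/
lemma three_terms_le_two_terms {Ω Γ : Type*} [MeasurableSpace Ω] [MeasurableSpace Γ]
    {P : Measure Ω} [IsProbabilityMeasure P] {Ξ : Ω → Measure Γ}
    [MeasurableSpace.CountablyGenerated Γ] [MeasurableSingletonClass Γ] (hΞ : Measurable Ξ)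
    (h4 : ∫⁻ ω, Ξ ω Set.univ ^ 4 ∂P < ∞) (a : ℝ) :
    a + 5.5 / massStd P Ξ ^ 3 * (meanSumCube P Ξ).toReal
        + 25.5 / massStd P Ξ ^ 3 * (sumSqMean P Ξ).toReal ≤
      a + 31 / massStd P Ξ ^ 3 * (meanSumCube P Ξ).toReal := by
  have hB : 0 ≤ massStd P Ξ := Real.sqrt_nonneg _
  have h := mul_le_mul_of_nonneg_left (toReal_sumSqMean_le hΞ h4)
    (by positivity : 0 ≤ 25.5 / massStd P Ξ ^ 3)
  have e : 31 / massStd P Ξ ^ 3 * (meanSumCube P Ξ).toReal =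
      5.5 / massStd P Ξ ^ 3 * (meanSumCube P Ξ).toReal
        + 25.5 / massStd P Ξ ^ 3 * (meanSumCube P Ξ).toReal := by ring
  linarith

end RandomMeasures

open RandomMeasures in
theorem theorem3 {Ω Γ : Type*} [MeasurableSpace Ω] (P : Measure Ω) [IsProbabilityMeasure P]
    [MetricSpace Γ] [LocallyCompactSpace Γ] [TopologicalSpace.SeparableSpace Γ]
    [MeasurableSpace Γ] [BorelSpace Γ]
    (Ξ : Ω → Measure Γ) (hΞ : IsRandomMeasure Ξ) :
    (IsCompletelyRandom P Ξ →
      (∫⁻ ω, Ξ ω Set.univ ^ 4 ∂P) < ∞ →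
      0 < variance (totalMass Ξ) P →
      sumCubeMean P Ξ < ∞ ∧ meanSumCube P Ξ < ∞ ∧ sumSqMean P Ξ < ∞ ∧
      normalDist P Ξ ≤
        10 / massStd P Ξ ^ 2 * √(sumCubeMean P Ξ).toReal
          + 5.5 / massStd P Ξ ^ 3 * (meanSumCube P Ξ).toReal
          + 25.5 / massStd P Ξ ^ 3 * (sumSqMean P Ξ).toReal ∧
      10 / massStd P Ξ ^ 2 * √(sumCubeMean P Ξ).toReal
          + 5.5 / massStd P Ξ ^ 3 * (meanSumCube P Ξ).toReal
          + 25.5 / massStd P Ξ ^ 3 * (sumSqMean P Ξ).toReal ≤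
        10 / massStd P Ξ ^ 2 * √(sumCubeMean P Ξ).toReal
          + 31 / massStd P Ξ ^ 3 * (meanSumCube P Ξ).toReal) ∧
    (∀ (Λ : Measure Γ) (l : ℝ), 0 < l → Λ Set.univ = ENNReal.ofReal l →
      IsPoissonProcess P Ξ Λ → IsSimple P Ξ →
      10 / massStd P Ξ ^ 2 * √(sumCubeMean P Ξ).toReal
          + 31 / massStd P Ξ ^ 3 * (meanSumCube P Ξ).toReal = 31 * l ^ (-(1 / 2) : ℝ) ∧
      normalDist P Ξ ≤ 31 * l ^ (-(1 / 2) : ℝ)) := by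
  have hΞm := hΞ.measurable
  have : SecondCountableTopology Γ := UniformSpace.secondCountable_of_separable Γ
  refine ⟨fun hcr h4 hvar => ⟨tsum_lintegral_pow_mul_meanMeasure_lt_top hΞm h4 (by norm_num),
    meanSumCube_lt_top h4, tsum_lintegral_pow_mul_meanMeasure_lt_top hΞm h4 (by norm_num), ?_,
    three_terms_le_two_terms hΞm h4 _⟩, fun Λ l hl hΛ hP hs => ?_⟩
  · have h := normalDist_le hΞm hcr h4 hvar
    have h0 : 0 ≤ 10 / massStd P Ξ ^ 2 * √(sumCubeMean P Ξ).toReal := by positivity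
    linarith
  · have : IsFiniteMeasure Λ := ⟨by rw [hΛ]; exact ENNReal.ofReal_lt_top⟩
    have h4 := hP.lintegral_pow_four_lt_top hΞm
    have hreal : Λ.real Set.univ = l := by rw [Measure.real, hΛ, ENNReal.toReal_ofReal hl.le]
    have hvar : variance (totalMass Ξ) P = l := by rw [hP.variance_totalMass hΞm, hreal]
    have hC : (meanSumCube P Ξ).toReal = l := by
      rw [hP.meanSumCube_eq hΞm hs]
      exact hreal
    have hB : massStd P Ξ = √l := by rw [massStd, hvar]
    have hval : 10 / massStd P Ξ ^ 2 * √(sumCubeMean P Ξ).toReal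
        + 31 / massStd P Ξ ^ 3 * (meanSumCube P Ξ).toReal = 31 * l ^ (-(1 / 2) : ℝ) := by
      rw [hP.sumCubeMean_eq_zero hΞm hs, hC, hB, Real.rpow_neg hl.le, ← Real.sqrt_eq_rpow]
      have hsq : √l ^ 2 = l := Real.sq_sqrt hl.le
      have hpos : 0 < √l := Real.sqrt_pos.2 hl
      simp only [ENNReal.toReal_zero, Real.sqrt_zero, mul_zero, zero_add]
      field_simp
      exact hsq.symm
    refine ⟨hval, ?_⟩
    have h := normalDist_le hΞm hP.indep h4 (by rw [hvar]; exact hl)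
    have h31 := three_terms_le_two_terms hΞm h4
      (10 / massStd P Ξ ^ 2 * √(sumCubeMean P Ξ).toReal)
    have h0 : 0 ≤ 10 / massStd P Ξ ^ 2 * √(sumCubeMean P Ξ).toReal := by positivity
    linarith
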